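/- **Theorem (Duality).** Let $\mathbb K$ be an algebraically closed field, $n\ge 0$, $S=\mathbb K[x_0,\dots,x_n]$ with the usual grading, $f_1,\dots,f_n\in S$ a regular sequence of homogeneous polynomials of degrees $d_1,\dots,d_n$, $T=S/(f_1,\dots,f_n)$ (a graded ring of dimension one), and $\tau=\sum_{i=1}^n d_i-n-1$. For a $\mathbb Z$-graded module $M$ write $M[a]_k=M_{a+k}$. A *maximal Cohen–Macaulay* (MCM) $T$-module is a nonzero finitely generated $\mathbb Z$-graded $T$-module $M$ whose depth in the irrelevant ideal $T_+$ equals $\dim T$. A *dualizing module* of $T$ is a finitely generated $\mathbb Z$-graded $T$-module $\Omega_T$ such that, for some homogeneous $x\in T$ of degree $e>0$ that is a nonzerodivisor on $T$ and on $\Omega_T$, there is an isomorphism of graded modules $\Omega_T/x\Omega_T\cong (T/xT)^\vee[-e]$, where $(T/xT)^\vee=\bigoplus_k \mathrm{Hom}_{\mathbb K}((T/xT)_{-k},\mathbb K)$. Then $T[\tau]$ is a dualizing module of $T$. Let $\Omega_T$ be any dualizing module of $T$ and let $D=\mathrm{Hom}_T(-,\Omega_T)$, where a homomorphism $M\to\Omega_T$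 has degree $k$ if it maps $M_j$ into $(\Omega_T)_{j+k}$ for all $j$. 1. If $M$ is an MCM $T$-module, then $D(M)$, with this grading, is an MCM $T$-module; in particular $D(M)\neq 0$. Moreover, if $x\in T$ is a nonzerodivisor on $M$ and on $T$, then $x$ is a nonzerodivisor on $D(M)$, and reduction of homomorphisms modulo $x$ induces an isomorphism of $T/xT$-modules $$D(M)/xD(M)\;\cong\;\mathrm{Hom}_{T/xT}(M/xM,\ \Omega_T/x\Omega_T),$$ which is an isomorphism of graded modules when $x$ is homogeneous. 2. If $0\to M_1\to M_2\to M_3\to 0$ is a short exact sequence of MCM $T$-modules and $T$-linear maps, then $0\to D(M_3)\to D(M_2)\to D(M_1)\to 0$ is exact. 3. If $M$ is an MCM $T$-module, the natural map $M\to D(D(M))$, $m\mapsto(\varphi\mapsto\varphi(m))$, is an isomorphism of graded modules. -/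

import Mathlib

universe u v w

namespace GradedDuality

/-! ### Graded modules over a `ℤ`-graded commutative ring -/

/-- `ℳ` is a `ℤ`-grading of the `R`-module `M`, compatible with the grading `𝒜` of `R`:
`M = ⨁ k, ℳ k` and `𝒜 i • ℳ j ⊆ ℳ (i + j)`. -/
structure IsGradedModule {R : Type u} [CommRing R] (𝒜 : ℤ → AddSubgroup R)
    {M : Type v} [AddCommGroup M] [Module R M] (ℳ : ℤ → AddSubgroup M) : Prop where
  isInternal : DirectSum.IsInternal ℳ
  smul_mem : ∀ (i j : ℤ) (r : R) (m : M), r ∈ 𝒜 i → m ∈ ℳ j → r • m ∈ ℳ (i + j)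

/-- The shifted (twisted) grading `M[a]`, with `M[a]_k = M_{a + k}`. -/
def shift {M : Type v} [AddCommGroup M] (ℳ : ℤ → AddSubgroup M) (a : ℤ) : ℤ → AddSubgroup M :=
  fun k => ℳ (a + k)

/-- The grading of `Hom_R(M, N)`: the maps of degree `k` are those that send `M_j` into
`N_{j + k}` for all `j`. -/
def homGrading {R : Type u} [CommRing R]
    {M : Type v} [AddCommGroup M] [Module R M] (ℳ : ℤ → AddSubgroup M)
    {N : Type w} [AddCommGroup N] [Module R N] (𝒩 : ℤ → AddSubgroup N) :
    ℤ → AddSubgroup (M →ₗ[R] N) := fun k =>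
  { carrier := {φ | ∀ j, ∀ m ∈ ℳ j, φ m ∈ 𝒩 (j + k)}
    zero_mem' := fun j _ _ => (𝒩 (j + k)).zero_mem
    add_mem' := fun ha hb j m hm => (𝒩 (j + k)).add_mem (ha j m hm) (hb j m hm)
    neg_mem' := fun ha j m hm => (𝒩 (j + k)).neg_mem (ha j m hm) }

/-- The quotient `M / xM`, a module over `R / xR`. -/
abbrev ModElt {R : Type u} [CommRing R] (x : R) (M : Type v) [AddCommGroup M] [Module R M] :
    Type v :=
  M ⧸ (Ideal.span {x} • (⊤ : Submodule R M))

/-- The class in `M / xM` of an element of `M`. -/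
abbrev toModElt {R : Type u} [CommRing R] (x : R) {M : Type v} [AddCommGroup M] [Module R M]
    (m : M) : ModElt x M :=
  Submodule.Quotient.mk m

/-- The family of subgroups of `M / xM` induced by a grading of `M` (it is a grading of `M / xM`
when `x` is homogeneous). -/
def modGrading {R : Type u} [CommRing R] (x : R)
    {M : Type v} [AddCommGroup M] [Module R M] (ℳ : ℤ → AddSubgroup M) :
    ℤ → AddSubgroup (ModElt x M) :=
  fun k => (ℳ k).map (Submodule.mkQ (Ideal.span {x} • (⊤ : Submodule R M))).toAddMonoidHom

/-! ### Depth and maximal Cohen-Macaulay modules -/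

/-- The ideal `R_+` generated by the homogeneous elements of positive degree. -/
def irrelevantIdeal {R : Type u} [CommRing R] (𝒜 : ℤ → AddSubgroup R) : Ideal R :=
  Ideal.span {r | ∃ k : ℤ, 0 < k ∧ r ∈ 𝒜 k}

/-- The depth of `M` in the ideal `I`: the supremum of the lengths of the `M`-regular sequences
of elements of `I`. The zero module has no regular sequences, hence depth `0` here. -/
noncomputable def depth {R : Type u} [CommRing R] (I : Ideal R)
    (M : Type v) [AddCommGroup M] [Module R M] : ℕ∞ :=
  ⨆ rs ∈ {rs : List R | (∀ r ∈ rs, r ∈ I) ∧ RingTheory.Sequence.IsRegular M rs},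
    (rs.length : ℕ∞)

/-- `M`, with the grading `ℳ`, is a maximal Cohen-Macaulay graded module over the graded ring
`R`: it is a nonzero finitely generated graded module whose depth (in `R_+`) is the Krull
dimension of `R`. -/
structure IsMCM {R : Type u} [CommRing R] (𝒜 : ℤ → AddSubgroup R)
    {M : Type v} [AddCommGroup M] [Module R M] (ℳ : ℤ → AddSubgroup M) : Prop where
  graded : IsGradedModule 𝒜 ℳ
  finite : Module.Finite R M
  nontrivial : Nontrivial M
  depth_eq : ((depth (irrelevantIdeal 𝒜) M : ℕ∞) : WithBot ℕ∞) = ringKrullDim R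

/-! ### Dualizing modules of one-dimensional graded algebras -/

/-- `Ω` (with the grading `𝒲`) is a dualizing (canonical) module of the one-dimensional graded
`K`-algebra `R`: it is a finitely generated graded module, and there is a homogeneous element `x`
of some degree `e > 0`, a nonzerodivisor on `R` and on `Ω`, such that `Ω / xΩ` is isomorphic, as
a graded module, to `ω[-e]`, where `ω = (R / xR)^∨ = Hom_K(R / xR, K)` is the dualizing module of
the zero-dimensional graded algebra `R / xR`.

Here `R` acts on `ω` by `(r • θ) a = θ (r • a)`, and `ω_k` is the space of functionals that
vanish on `(R / xR)_j` for all `j ≠ -k`, so that `ω[-e]_i = ω_{i - e}` is the space of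
functionals that vanish on `(R / xR)_j` unless `i + j = e`. (`R / xR` has finite dimension over
`K`, so that the graded dual is the full dual.) -/
def IsDualizing (K : Type u) [Field K] {R : Type u} [CommRing R] [Algebra K R]
    (𝒜 : ℤ → AddSubgroup R)
    {Ω : Type w} [AddCommGroup Ω] [Module R Ω] (𝒲 : ℤ → AddSubgroup Ω) : Prop :=
  IsGradedModule 𝒜 𝒲 ∧ Module.Finite R Ω ∧
    ∃ (e : ℤ) (x : R), 0 < e ∧ x ∈ 𝒜 e ∧ IsSMulRegular R x ∧ IsSMulRegular Ω x ∧
      ∃ ε : ModElt x Ω ≃+ Module.Dual K (R ⧸ Ideal.span {x}),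
        (∀ (r : R) (w : ModElt x Ω) (a : R ⧸ Ideal.span {x}), ε (r • w) a = ε w (r • a)) ∧
        ∀ (i j : ℤ) (w : Ω) (a : R), w ∈ 𝒲 i → a ∈ 𝒜 j → i + j ≠ e →
          ε (toModElt x w) (Ideal.Quotient.mk (Ideal.span {x}) a) = 0

/-! ### The graded ring `T = K[x_0, …, x_n] / (f_1, …, f_n)` -/

/-- The quotient ring `T = K[x_0, …, x_n] / (f_1, …, f_n)`. -/
def CIRing {K : Type u} [Field K] {n : ℕ} (f : Fin n → MvPolynomial (Fin (n + 1)) K) : Type u :=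
  MvPolynomial (Fin (n + 1)) K ⧸ Ideal.span (Set.range f)

noncomputable instance {K : Type u} [Field K] {n : ℕ}
    (f : Fin n → MvPolynomial (Fin (n + 1)) K) : CommRing (CIRing f) :=
  inferInstanceAs (CommRing (MvPolynomial (Fin (n + 1)) K ⧸ Ideal.span (Set.range f)))

noncomputable instance {K : Type u} [Field K] {n : ℕ}
    (f : Fin n → MvPolynomial (Fin (n + 1)) K) : Algebra K (CIRing f) :=
  inferInstanceAs (Algebra K (MvPolynomial (Fin (n + 1)) K ⧸ Ideal.span (Set.range f)))

/-- The quotient map `K[x_0, …, x_n] → T`. -/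
noncomputable def CIRing.mk {K : Type u} [Field K] {n : ℕ}
    (f : Fin n → MvPolynomial (Fin (n + 1)) K) : MvPolynomial (Fin (n + 1)) K →+* CIRing f :=
  Ideal.Quotient.mk (Ideal.span (Set.range f))

/-- The grading of `T` induced by the usual grading of the polynomial ring: `T_k` is the image of
the homogeneous polynomials of degree `k` if `k ≥ 0`, and `T_k = 0` if `k < 0`. -/
noncomputable def ciGrading {K : Type u} [Field K] {n : ℕ} (f : Fin n → MvPolynomial (Fin (n + 1)) K) :
    ℤ → AddSubgroup (CIRing f) := fun k =>
  if 0 ≤ k then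
    (MvPolynomial.homogeneousSubmodule (Fin (n + 1)) K k.toNat).toAddSubgroup.map
      (CIRing.mk f).toAddMonoidHom
  else ⊥

end GradedDuality

/-! Duality over `T` is reduced to the duality of finite free modules over a polynomial ring in one
variable. Let `x`, homogeneous of degree `e > 0`, be the element supplied by the definition of a
dualizing module, and let `A = K[X]` act through `X ↦ x`. By graded Nakayama `T` is finite over `A`.
A nonzero finitely generated graded `T`-module is MCM exactly when `x` is regular on it
(`isSMulRegular_of_isMCM`, `isMCM_of_isSMulRegular`), and it is then torsion-free, hence free, over
the principal ideal domain `A` (`free_of_isSMulRegular`).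

The isomorphism `Ω/xΩ ≅ (T/xT)^∨[-e]` lifts from `K = A/XA` to `A`: there is an `A`-linear form `lam
: Ω → A` inducing `Ω ≅ Hom_A(T, A)` (`exists_isPerfectForm`). By adjunction `Hom_T(M, Ω) ≅ Hom_A(M,
A)` for every `T`-module `M`. So `D` becomes the ordinary `A`-dual: it is exact on sequences that
split over `A`, it is reflexive on finite free modules, and homomorphisms to `Ω/yΩ` lift to `Ω`
because extensions of `M` by `Ω` split. All three assertions follow for any graded curve
(`duality_of_isGradedCurve`).

For `T[τ]`, two facts about the complete intersection are needed. First, some linear form `ℓ` is a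
nonzerodivisor on `T`: regular sequences of equal length can be exchanged without creating a socle,
so `f` may be compared with `n` of the variables (`socleFree_of_regularSeqMod`), and prime avoidance
over an infinite field does the rest. Secondly, `S/(f, ℓ)` is Gorenstein with socle in degree `∑ (d
i - 1) = τ + 1`: this is visible for powers of independent linear forms, and it is carried over to
`(f, ℓ)` by replacing one generator at a time (`HasSocleForm.replace`,
`hasSocleForm_of_regularSeqMod`). The resulting pairing identifies `T/ℓT` with its dual, in the
required degrees. -/

namespace GradedDuality

/-! ### Homogeneous components -/

section Components

variable {M : Type*} [AddCommGroup M] {ℳ : ℤ → AddSubgroup M}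

/-- The homogeneous component of degree `k`, as an additive endomorphism. -/
noncomputable def component (h : DirectSum.IsInternal ℳ) (k : ℤ) : M →+ M :=
  (ℳ k).subtype.comp ((DFinsupp.evalAddMonoidHom k).comp
    (AddEquiv.ofBijective (DirectSum.coeAddMonoidHom ℳ) h).symm.toAddMonoidHom)

theorem component_coe (h : DirectSum.IsInternal ℳ) (k : ℤ) (a : DirectSum ℤ fun i => ℳ i) :
    component h k (DirectSum.coeAddMonoidHom ℳ a) = a k := by
  have : (AddEquiv.ofBijective (DirectSum.coeAddMonoidHom ℳ) h).symm
      (DirectSum.coeAddMonoidHom ℳ a) = a :=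
    (AddEquiv.ofBijective (DirectSum.coeAddMonoidHom ℳ) h).symm_apply_apply a
  change ((((AddEquiv.ofBijective (DirectSum.coeAddMonoidHom ℳ) h).symm
      (DirectSum.coeAddMonoidHom ℳ a)) k : ℳ k) : M) = a k
  rw [this]

theorem component_mem (h : DirectSum.IsInternal ℳ) (k : ℤ) (m : M) : component h k m ∈ ℳ k :=
  Subtype.property _

theorem component_of_mem (h : DirectSum.IsInternal ℳ) {k : ℤ} {m : M} (hm : m ∈ ℳ k) :
    component h k m = m := by
  have := component_coe h k (DirectSum.of (fun i => ℳ i) k ⟨m, hm⟩)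
  rwa [DirectSum.coeAddMonoidHom_of, DirectSum.of_eq_same] at this

theorem component_of_mem_ne (h : DirectSum.IsInternal ℳ) {j k : ℤ} (hjk : j ≠ k) {m : M}
    (hm : m ∈ ℳ j) : component h k m = 0 := by
  have := component_coe h k (DirectSum.of (fun i => ℳ i) j ⟨m, hm⟩)
  rwa [DirectSum.coeAddMonoidHom_of, DirectSum.of_eq_of_ne _ _ _ hjk.symm] at this

theorem homogeneous_induction (h : DirectSum.IsInternal ℳ) {P : M → Prop} (m : M) (zero : P 0)
    (homogeneous : ∀ k, ∀ m ∈ ℳ k, P m) (add : ∀ m m', P m → P m' → P (m + m')) : P m := by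
  obtain ⟨a, rfl⟩ := h.surjective m
  induction a using DirectSum.induction_on with
  | zero => simpa using zero
  | of i x => rw [DirectSum.coeAddMonoidHom_of]; exact homogeneous i _ x.2
  | add x y hx hy => rw [map_add]; exact add _ _ hx hy

theorem exists_sum_component (h : DirectSum.IsInternal ℳ) (m : M) :
    ∃ F : Finset ℤ, (∀ k ∉ F, component h k m = 0) ∧ m = ∑ k ∈ F, component h k m := by
  suffices H : ∃ F : Finset ℤ, ∀ G, F ⊆ G → (∀ k ∉ G, component h k m = 0) ∧
      m = ∑ k ∈ G, component h k m by
    obtain ⟨F, hF⟩ := H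
    exact ⟨F, hF F subset_rfl⟩
  induction m using homogeneous_induction h with
  | zero => exact ⟨∅, fun G _ => by simp⟩
  | homogeneous k m hm =>
    refine ⟨{k}, fun G hG => ⟨fun j hj => component_of_mem_ne h ?_ hm, ?_⟩⟩
    · rintro rfl
      exact hj (hG (by simp))
    · rw [Finset.sum_eq_single k, component_of_mem h hm]
      · exact fun j _ hj => component_of_mem_ne h hj.symm hm
      · exact fun hk => absurd (hG (by simp)) hk
  | add m m' hm hm' =>
    obtain ⟨F, hF⟩ := hm
    obtain ⟨F', hF'⟩ := hm'
    refine ⟨F ∪ F', fun G hG => ?_⟩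
    obtain ⟨h1, h2⟩ := hF G (Finset.union_subset_left hG)
    obtain ⟨h3, h4⟩ := hF' G (Finset.union_subset_right hG)
    refine ⟨fun k hk => by rw [map_add, h1 k hk, h3 k hk, add_zero], ?_⟩
    simp only [map_add, Finset.sum_add_distrib, ← h2, ← h4]

theorem eq_zero_of_component (h : DirectSum.IsInternal ℳ) {m : M}
    (hm : ∀ k, component h k m = 0) : m = 0 := by
  obtain ⟨F, -, hF⟩ := exists_sum_component h m
  rw [hF]
  exact Finset.sum_eq_zero fun k _ => hm k

theorem mem_of_component (h : DirectSum.IsInternal ℳ) {k : ℤ} {m : M}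
    (hm : ∀ j, j ≠ k → component h j m = 0) : m ∈ ℳ k := by
  have : m - component h k m = 0 := by
    refine eq_zero_of_component h fun j => ?_
    rw [map_sub]
    by_cases hj : j = k
    · subst hj
      rw [component_of_mem h (component_mem h j m), sub_self]
    · rw [hm j hj, component_of_mem_ne h (Ne.symm hj) (component_mem h k m), sub_self]
  rw [sub_eq_zero.mp this]
  exact component_mem h k m

/-- Projections behaving like homogeneous components determine the coordinates of an element of the
direct sum, which gives injectivity; the finite sums give surjectivity. All gradings constructed
below are verified in this way. -/
theorem isInternal_of_components (p : ℤ → M →+ M) (hmem : ∀ k m, p k m ∈ ℳ k)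
    (hsame : ∀ k, ∀ m ∈ ℳ k, p k m = m) (hne : ∀ j k, j ≠ k → ∀ m ∈ ℳ j, p k m = 0)
    (hsum : ∀ m, ∃ F : Finset ℤ, m = ∑ k ∈ F, p k m) : DirectSum.IsInternal ℳ := by
  constructor
  · rw [injective_iff_map_eq_zero]
    intro a ha
    have key : ∀ (a : DirectSum ℤ fun i => ℳ i) (k : ℤ),
        p k (DirectSum.coeAddMonoidHom ℳ a) = a k := by
      intro a k
      induction a using DirectSum.induction_on with
      | zero => simp
      | of i x =>
        rw [DirectSum.coeAddMonoidHom_of]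
        by_cases hik : i = k
        · subst hik
          rw [DirectSum.of_eq_same, hsame i _ x.2]
        · rw [DirectSum.of_eq_of_ne _ _ _ (Ne.symm hik), hne i k hik _ x.2]
          rfl
      | add x y hx hy => rw [map_add, map_add, hx, hy]; rfl
    refine DFinsupp.ext fun k => Subtype.ext ?_
    rw [← key a k, ha, map_zero]
    rfl
  · intro m
    obtain ⟨F, hF⟩ := hsum m
    refine ⟨∑ k ∈ F, DirectSum.of (fun i => ℳ i) k ⟨p k m, hmem k m⟩, ?_⟩
    rw [map_sum]
    simp only [DirectSum.coeAddMonoidHom_of]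
    exact hF.symm

/-- The additive map whose values on homogeneous elements of degree `j` are given by `q j`. -/
noncomputable def ofHomogeneous {N : Type*} [AddCommGroup N] (h : DirectSum.IsInternal ℳ)
    (q : ℤ → M →+ N) : M →+ N :=
  (DirectSum.toAddMonoid fun j => (q j).comp (ℳ j).subtype).comp
    (AddEquiv.ofBijective (DirectSum.coeAddMonoidHom ℳ) h).symm.toAddMonoidHom

theorem ofHomogeneous_of_mem {N : Type*} [AddCommGroup N] (h : DirectSum.IsInternal ℳ)
    (q : ℤ → M →+ N) {j : ℤ} {m : M} (hm : m ∈ ℳ j) : ofHomogeneous h q m = q j m := by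
  have : (AddEquiv.ofBijective (DirectSum.coeAddMonoidHom ℳ) h).symm m =
      DirectSum.of (fun i => ℳ i) j ⟨m, hm⟩ := by
    rw [AddEquiv.symm_apply_eq]
    exact (DirectSum.coeAddMonoidHom_of ℳ j ⟨m, hm⟩).symm
  change DirectSum.toAddMonoid _ ((AddEquiv.ofBijective (DirectSum.coeAddMonoidHom ℳ) h).symm m) = _
  rw [this, DirectSum.toAddMonoid_of]
  rfl

theorem shift_isInternal (h : DirectSum.IsInternal ℳ) (a : ℤ) :
    DirectSum.IsInternal (shift ℳ a) := by
  refine isInternal_of_components (fun k => component h (a + k))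
    (fun k m => component_mem h _ m) (fun k m hm => component_of_mem h hm)
    (fun j k hjk m hm => component_of_mem_ne h (by simpa using hjk) hm) fun m => ?_
  obtain ⟨F, -, hF⟩ := exists_sum_component h m
  refine ⟨F.image (fun k => k - a), ?_⟩
  rw [Finset.sum_image (by intro x _ y _ hxy; simpa using hxy)]
  simpa using hF

end Components

/-! ### Graded modules -/

section GradedModule

variable {R : Type*} [CommRing R] {𝒜 : ℤ → AddSubgroup R}
variable {M : Type*} [AddCommGroup M] [Module R M] {ℳ : ℤ → AddSubgroup M}
variable {N : Type*} [AddCommGroup N] [Module R N] {𝒩 : ℤ → AddSubgroup N}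

theorem IsGradedModule.component_smul (h : IsGradedModule 𝒜 ℳ) {i k : ℤ} {r : R} (hr : r ∈ 𝒜 i)
    (m : M) : component h.isInternal (i + k) (r • m) = r • component h.isInternal k m := by
  induction m using homogeneous_induction h.isInternal with
  | zero => simp
  | homogeneous j m hm =>
    by_cases hjk : j = k
    · subst hjk
      rw [component_of_mem h.isInternal hm, component_of_mem h.isInternal (h.smul_mem _ _ _ _ hr hm)]
    · rw [component_of_mem_ne h.isInternal hjk hm, smul_zero,
        component_of_mem_ne h.isInternal (by simpa using hjk) (h.smul_mem _ _ _ _ hr hm)]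
  | add m m' hm hm' => rw [smul_add, map_add, map_add, smul_add, hm, hm']

theorem IsGradedModule.shift (h : IsGradedModule 𝒜 ℳ) (a : ℤ) :
    IsGradedModule 𝒜 (shift ℳ a) where
  isInternal := shift_isInternal h.isInternal a
  smul_mem i j r m hr hm := by
    have := h.smul_mem i (a + j) r m hr hm
    change r • m ∈ ℳ (a + (i + j))
    rwa [show a + (i + j) = i + (a + j) by ring]

/-- The component of degree `k` of a homomorphism of graded modules. -/
noncomputable def homComponent (hA : IsGradedModule 𝒜 𝒜) (hM : IsGradedModule 𝒜 ℳ)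
    (hN : IsGradedModule 𝒜 𝒩) (k : ℤ) : (M →ₗ[R] N) →+ (M →ₗ[R] N) where
  toFun φ :=
    { toFun := ofHomogeneous hM.isInternal fun j =>
        (component hN.isInternal (j + k)).comp φ.toAddMonoidHom
      map_add' := map_add _
      map_smul' := by
        intro r m
        rw [RingHom.id_apply]
        induction r using homogeneous_induction hA.isInternal with
        | zero => simp
        | add r r' hr hr' => rw [add_smul, map_add, hr, hr', add_smul]
        | homogeneous i r hr =>
          induction m using homogeneous_induction hM.isInternal with
          | zero => simp
          | add m m' hm hm' => rw [smul_add, map_add, hm, hm', map_add, smul_add]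
          | homogeneous j m hm =>
            rw [ofHomogeneous_of_mem _ _ hm, ofHomogeneous_of_mem _ _ (hM.smul_mem _ _ _ _ hr hm)]
            simp only [AddMonoidHom.comp_apply, LinearMap.toAddMonoidHom_coe, map_smul]
            rw [add_assoc, hN.component_smul hr] }
  map_zero' := by
    ext m
    simp only [LinearMap.coe_mk, AddHom.coe_mk, LinearMap.zero_apply]
    change ofHomogeneous hM.isInternal (fun j =>
        (component hN.isInternal (j + k)).comp (0 : M →ₗ[R] N).toAddMonoidHom) m = 0
    induction m using homogeneous_induction hM.isInternal with
    | zero => simp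
    | add m m' hm hm' => rw [map_add, hm, hm', add_zero]
    | homogeneous j m hm => rw [ofHomogeneous_of_mem _ _ hm]; simp
  map_add' φ ψ := by
    ext m
    change ofHomogeneous hM.isInternal (fun j =>
        (component hN.isInternal (j + k)).comp (φ + ψ).toAddMonoidHom) m =
      ofHomogeneous hM.isInternal (fun j =>
        (component hN.isInternal (j + k)).comp φ.toAddMonoidHom) m +
      ofHomogeneous hM.isInternal (fun j =>
        (component hN.isInternal (j + k)).comp ψ.toAddMonoidHom) m
    induction m using homogeneous_induction hM.isInternal with
    | zero => simp
    | add m m' hm hm' => rw [map_add, hm, hm', map_add, map_add]; abel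
    | homogeneous j m hm => simp only [ofHomogeneous_of_mem _ _ hm]; simp

theorem homComponent_of_mem (hA : IsGradedModule 𝒜 𝒜) (hM : IsGradedModule 𝒜 ℳ)
    (hN : IsGradedModule 𝒜 𝒩) (k : ℤ) (φ : M →ₗ[R] N) {j : ℤ} {m : M} (hm : m ∈ ℳ j) :
    homComponent hA hM hN k φ m = component hN.isInternal (j + k) (φ m) :=
  ofHomogeneous_of_mem _ _ hm

theorem homComponent_mem (hA : IsGradedModule 𝒜 𝒜) (hM : IsGradedModule 𝒜 ℳ)
    (hN : IsGradedModule 𝒜 𝒩) (k : ℤ) (φ : M →ₗ[R] N) :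
    homComponent hA hM hN k φ ∈ homGrading (R := R) ℳ 𝒩 k := by
  intro j m hm
  rw [homComponent_of_mem hA hM hN k φ hm]
  exact component_mem _ _ _

theorem linearMap_eq_zero_of_homogeneous (hM : IsGradedModule 𝒜 ℳ) {φ : M →ₗ[R] N}
    (h : ∀ j, ∀ m ∈ ℳ j, φ m = 0) : φ = 0 := by
  ext m
  induction m using homogeneous_induction hM.isInternal with
  | zero => simp
  | add m m' hm hm' => rw [map_add, hm, hm', map_add]
  | homogeneous j m hm => rw [h j m hm, LinearMap.zero_apply]

/-- Finite generation of `M` is what makes a homomorphism a finite sum of its components: a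
component vanishes once it vanishes on the generators. -/
theorem homGrading_isInternal (hA : IsGradedModule 𝒜 𝒜) (hM : IsGradedModule 𝒜 ℳ)
    (hN : IsGradedModule 𝒜 𝒩) [Module.Finite R M] :
    DirectSum.IsInternal (homGrading (R := R) ℳ 𝒩) := by
  classical
  refine isInternal_of_components (homComponent hA hM hN) (homComponent_mem hA hM hN) ?_ ?_ ?_
  · intro k φ hφ
    rw [← sub_eq_zero]
    refine linearMap_eq_zero_of_homogeneous hM fun j m hm => ?_
    rw [LinearMap.sub_apply, homComponent_of_mem hA hM hN k φ hm,
      component_of_mem _ (hφ j m hm), sub_self]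
  · intro i k hik φ hφ
    refine linearMap_eq_zero_of_homogeneous hM fun j m hm => ?_
    rw [homComponent_of_mem hA hM hN k φ hm,
      component_of_mem_ne _ (by simpa using hik) (hφ j m hm)]
  · intro φ
    obtain ⟨G, hG⟩ := (Module.Finite.fg_top : (⊤ : Submodule R M).FG)
    choose F hF0 hF using fun m : M => exists_sum_component hM.isInternal m
    choose E hE0 hE using fun n : N => exists_sum_component hN.isInternal n
    -- The possible degrees of `φ`: differences `i - j`, where a generator has a part in degree `j`
    -- whose image has a part in degree `i`.
    let B : Finset ℤ := G.biUnion fun g => (F g).biUnion fun j =>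
      (E (φ (component hM.isInternal j g))).image fun i => i - j
    have hB : ∀ k ∉ B, homComponent hA hM hN k φ = 0 := by
      intro k hk
      refine LinearMap.ext_on (s := (G : Set M)) (by rw [hG]) fun g hg => ?_
      rw [hF g, map_sum, map_sum]
      refine Finset.sum_congr rfl fun j hj => ?_
      rw [homComponent_of_mem hA hM hN k φ (component_mem _ j g), LinearMap.zero_apply]
      refine hE0 _ _ fun hmem => hk ?_
      simp only [B, Finset.mem_biUnion, Finset.mem_image]
      exact ⟨g, hg, j, hj, _, hmem, by ring⟩
    refine ⟨B, ?_⟩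
    rw [← sub_eq_zero]
    refine linearMap_eq_zero_of_homogeneous hM fun j m hm => ?_
    rw [LinearMap.sub_apply, LinearMap.sum_apply, sub_eq_zero]
    have h1 : ∀ k ∉ B, component hN.isInternal (j + k) (φ m) = 0 := by
      intro k hk
      rw [← homComponent_of_mem hA hM hN k φ hm, hB k hk, LinearMap.zero_apply]
    rw [Finset.sum_congr rfl fun k _ => homComponent_of_mem hA hM hN k φ hm]
    rw [← Finset.sum_image (f := fun i => component hN.isInternal i (φ m)) (s := B)
      (g := fun k => j + k) (by intro x _ y _ hxy; simpa using hxy)]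
    nth_rw 1 [hE (φ m)]
    have h2 : ∀ i ∉ B.image (fun k => j + k), component hN.isInternal i (φ m) = 0 := by
      intro i hi
      have := h1 (i - j) fun hB' => hi (Finset.mem_image.mpr ⟨_, hB', by ring⟩)
      rwa [show j + (i - j) = i by ring] at this
    rw [Finset.sum_subset (Finset.subset_union_left (s₂ := B.image (fun k => j + k)))
        fun i _ hi => hE0 _ i hi,
      ← Finset.sum_subset (Finset.subset_union_right (s₁ := E (φ m))) fun i _ hi => h2 i hi]

theorem homGrading_isGradedModule (hA : IsGradedModule 𝒜 𝒜) (hM : IsGradedModule 𝒜 ℳ)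
    (hN : IsGradedModule 𝒜 𝒩) [Module.Finite R M] :
    IsGradedModule 𝒜 (homGrading (R := R) ℳ 𝒩) where
  isInternal := homGrading_isInternal hA hM hN
  smul_mem i k r φ hr hφ j m hm := by
    rw [LinearMap.smul_apply, show j + (i + k) = i + (j + k) by ring]
    exact hN.smul_mem _ _ _ _ hr (hφ j m hm)

end GradedModule

end GradedDuality

namespace GradedDuality

theorem finite_linearMap {R : Type*} [CommRing R] [IsNoetherianRing R] (M N : Type*)
    [AddCommGroup M] [Module R M] [AddCommGroup N] [Module R N] [Module.Finite R M]
    [Module.Finite R N] : Module.Finite R (M →ₗ[R] N) := by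
  obtain ⟨n, f, hf⟩ := Module.Finite.exists_fin' R M
  exact Module.Finite.of_injective (LinearMap.lcomp R N f) fun φ ψ h => LinearMap.ext fun t => by
    obtain ⟨v, rfl⟩ := hf t
    exact LinearMap.congr_fun h v

/-! ### Reduction modulo an element -/

section Reduction

variable {R : Type*} [CommRing R] {x : R}
variable {M : Type*} [AddCommGroup M] [Module R M] {N : Type*} [AddCommGroup N] [Module R N]

theorem toModElt_eq_zero_iff {m : M} : toModElt x m = 0 ↔ ∃ m' : M, x • m' = m := by
  rw [toModElt, Submodule.Quotient.mk_eq_zero, Submodule.ideal_span_singleton_smul,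
    Submodule.mem_smul_pointwise_iff_exists]
  simp

theorem toModElt_surjective (a : ModElt x M) : ∃ m : M, toModElt x m = a :=
  Submodule.Quotient.mk_surjective _ a

theorem toModElt_eq_iff {m m' : M} : toModElt x m = toModElt x m' ↔ ∃ n : M, x • n = m - m' := by
  rw [← toModElt_eq_zero_iff, ← sub_eq_zero]
  rfl

theorem mk_smul_toModElt (r : R) (m : M) :
    (Ideal.Quotient.mk (Ideal.span {x}) r) • toModElt x m = toModElt x (r • m) := rfl

/-- The reduction of a homomorphism modulo `x`. -/
noncomputable def reduceHom (x : R) (φ : M →ₗ[R] N) :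
    ModElt x M →ₗ[R ⧸ Ideal.span {x}] ModElt x N where
  toFun := Submodule.mapQ _ _ φ (by
    rw [← Submodule.map_le_iff_le_comap, Submodule.map_smul'']
    exact Submodule.smul_mono le_rfl le_top)
  map_add' := map_add _
  map_smul' := by
    intro r a
    obtain ⟨r, rfl⟩ := Ideal.Quotient.mk_surjective r
    obtain ⟨m, rfl⟩ := toModElt_surjective a
    rw [mk_smul_toModElt, RingHom.id_apply]
    simp only [toModElt, Submodule.mapQ_apply, map_smul]
    rfl

theorem reduceHom_toModElt (φ : M →ₗ[R] N) (m : M) :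
    reduceHom x φ (toModElt x m) = toModElt x (φ m) := rfl

/-- Injectivity is division by `x`: if `φ` maps `M` into `xN`, the quotients are unique because `x`
is regular on `N`, hence form a linear map. Surjectivity is the lifting hypothesis, which amounts to
a vanishing of extensions. -/
theorem exists_reduction_equiv (hx : IsSMulRegular N x)
    (hlift : ∀ ψ : M →ₗ[R] ModElt x N, ∃ φ : M →ₗ[R] N, ∀ m, toModElt x (φ m) = ψ m) :
    ∃ ε : ModElt x (M →ₗ[R] N) ≃ₗ[R ⧸ Ideal.span {x}]
        (ModElt x M →ₗ[R ⧸ Ideal.span {x}] ModElt x N),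
      ∀ (φ : M →ₗ[R] N) (m : M), ε (toModElt x φ) (toModElt x m) = toModElt x (φ m) := by
  have hext : ∀ {ψ ψ' : ModElt x M →ₗ[R ⧸ Ideal.span {x}] ModElt x N},
      (∀ m, ψ (toModElt x m) = ψ' (toModElt x m)) → ψ = ψ' := by
    intro ψ ψ' h
    refine LinearMap.ext fun a => ?_
    obtain ⟨m, rfl⟩ := toModElt_surjective a
    exact h m
  -- `F` reduces an arbitrarily chosen representative; `hF` shows that the choice does not matter.
  let F : ModElt x (M →ₗ[R] N) → (ModElt x M →ₗ[R ⧸ Ideal.span {x}] ModElt x N) :=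
    fun a => reduceHom x (toModElt_surjective a).choose
  have hF : ∀ φ m, F (toModElt x φ) (toModElt x m) = toModElt x (φ m) := by
    intro φ m
    obtain ⟨χ, hχ⟩ := toModElt_eq_iff.mp (toModElt_surjective (toModElt x φ)).choose_spec
    simp only [F]
    rw [reduceHom_toModElt, toModElt_eq_iff]
    exact ⟨χ m, by rw [← LinearMap.smul_apply, hχ, LinearMap.sub_apply]⟩
  let L : ModElt x (M →ₗ[R] N) →ₗ[R ⧸ Ideal.span {x}]
      (ModElt x M →ₗ[R ⧸ Ideal.span {x}] ModElt x N) :=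
    { toFun := F
      map_add' := by
        intro a b
        obtain ⟨φ, rfl⟩ := toModElt_surjective a
        obtain ⟨ψ, rfl⟩ := toModElt_surjective b
        refine hext fun m => ?_
        rw [LinearMap.add_apply, hF, hF]
        exact hF (φ + ψ) m
      map_smul' := by
        intro r a
        obtain ⟨r, rfl⟩ := Ideal.Quotient.mk_surjective r
        obtain ⟨φ, rfl⟩ := toModElt_surjective a
        refine hext fun m => ?_
        rw [LinearMap.smul_apply, RingHom.id_apply, hF]
        exact hF (r • φ) m }
  refine ⟨LinearEquiv.ofBijective L ⟨?_, ?_⟩, fun φ m => hF φ m⟩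
  · rw [injective_iff_map_eq_zero]
    intro a ha
    obtain ⟨φ, rfl⟩ := toModElt_surjective a
    have h1 : ∀ m, ∃ n, x • n = φ m := fun m => toModElt_eq_zero_iff.mp <| by
      rw [← hF φ m]
      change L (toModElt x φ) (toModElt x m) = 0
      rw [ha, LinearMap.zero_apply]
    choose q hq using h1
    refine toModElt_eq_zero_iff.mpr ⟨{ toFun := q, map_add' := ?_, map_smul' := ?_ }, ?_⟩
    · exact fun m m' => hx (by simp only [smul_add, hq, map_add])
    · exact fun r m => hx (by simp only [RingHom.id_apply]; rw [smul_comm, hq, hq, map_smul])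
    · ext m
      exact hq m
  · intro ψ
    obtain ⟨φ, hφ⟩ := hlift
      { toFun := fun m => ψ (toModElt x m)
        map_add' := fun m m' => map_add ψ (toModElt x m) (toModElt x m')
        map_smul' := fun r m => ψ.map_smul (Ideal.Quotient.mk _ r) (toModElt x m) }
    exact ⟨toModElt x φ, hext fun m => (hF φ m).trans (hφ m)⟩

theorem mem_modGrading_homGrading_iff {𝒜 : ℤ → AddSubgroup R} {ℳ : ℤ → AddSubgroup M}
    {𝒩 : ℤ → AddSubgroup N} (hA : IsGradedModule 𝒜 𝒜) (hM : IsGradedModule 𝒜 ℳ)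
    (hN : IsGradedModule 𝒜 𝒩)
    (ε : ModElt x (M →ₗ[R] N) ≃ₗ[R ⧸ Ideal.span {x}]
        (ModElt x M →ₗ[R ⧸ Ideal.span {x}] ModElt x N))
    (hε : ∀ (φ : M →ₗ[R] N) (m : M), ε (toModElt x φ) (toModElt x m) = toModElt x (φ m))
    {e : ℤ} (hx : x ∈ 𝒜 e) (k : ℤ) (a : ModElt x (M →ₗ[R] N)) :
    a ∈ modGrading x (homGrading (R := R) ℳ 𝒩) k ↔
      ε a ∈ homGrading (R := R ⧸ Ideal.span {x}) (modGrading x ℳ) (modGrading x 𝒩) k := by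
  constructor
  · rintro ⟨φ, hφ, rfl⟩ j b ⟨m, hm, rfl⟩
    exact ⟨φ m, hφ j m hm, (hε φ m).symm⟩
  · intro ha
    obtain ⟨φ, rfl⟩ := toModElt_surjective a
    -- An arbitrary lift need not be homogeneous, but its component of degree `k` has the same
    -- reduction.
    refine ⟨homComponent hA hM hN k φ, homComponent_mem hA hM hN k φ, ε.injective (LinearMap.ext fun b => ?_)⟩
    obtain ⟨m, rfl⟩ := toModElt_surjective b
    change ε (toModElt x _) (toModElt x m) = _
    rw [hε, hε]
    induction m using homogeneous_induction hM.isInternal with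
    | zero => simp
    | add m m' hm hm' =>
      rw [map_add, map_add]
      exact congrArg₂ (· + ·) hm hm'
    | homogeneous j m hm =>
      rw [homComponent_of_mem hA hM hN k φ hm]
      obtain ⟨n, hn, hn'⟩ := ha j (toModElt x m) ⟨m, hm, rfl⟩
      change toModElt x n = _ at hn'
      rw [hε, toModElt_eq_iff] at hn'
      obtain ⟨v, hv⟩ := hn'
      rw [toModElt_eq_iff]
      refine ⟨component hN.isInternal (j + k - e) (-v) + v, ?_⟩
      rw [smul_add, ← hN.component_smul hx, smul_neg, hv, show e + (j + k - e) = j + k by ring,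
        neg_sub, map_sub, component_of_mem _ hn]
      abel

end Reduction

/-! ### Duality with respect to a perfect form -/

section PerfectForm

variable {A : Type*} [CommRing A] {T : Type*} [CommRing T] [Algebra A T]
variable {Ω : Type*} [AddCommGroup Ω] [Module T Ω] [Module A Ω]

variable (T) in
/-- The `A`-linear form `lam` on the `T`-module `Ω` induces an isomorphism
`Ω ≅ Hom_A(T, A)`, `w ↦ (t ↦ lam (t • w))`. -/
structure IsPerfectForm (lam : Ω →ₗ[A] A) : Prop where
  eq_zero : ∀ w : Ω, (∀ t : T, lam (t • w) = 0) → w = 0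
  exists_rep : ∀ μ : T →ₗ[A] A, ∃ w : Ω, ∀ t : T, lam (t • w) = μ t

namespace IsPerfectForm

variable {lam : Ω →ₗ[A] A} (hl : IsPerfectForm T lam)

include hl

theorem eq_of_forall {w w' : Ω} (h : ∀ t : T, lam (t • w) = lam (t • w')) : w = w' :=
  sub_eq_zero.mp <| hl.eq_zero _ fun t => by rw [smul_sub, map_sub, h, sub_self]

theorem hom_ext {M : Type*} [AddCommGroup M] [Module T M] {φ ψ : M →ₗ[T] Ω} (h : ∀ m, lam (φ m) = lam (ψ m)) : φ = ψ := by
  ext m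
  exact hl.eq_of_forall fun t => by rw [← map_smul, ← map_smul, h]

variable {M : Type*} [AddCommGroup M] [Module T M] [Module A M] [IsScalarTower A T M]

/-- This is the adjunction `Hom_T(M, Hom_A(T, A)) ≅ Hom_A(M, A)`: the element representing `t ↦ μ (t
• m)` is the value at `m`. -/
theorem exists_hom (μ : M →ₗ[A] A) : ∃ φ : M →ₗ[T] Ω, ∀ m, lam (φ m) = μ m := by
  have h1 : ∀ m : M, ∃ w : Ω, ∀ t : T, lam (t • w) = μ (t • m) := fun m =>
    hl.exists_rep (μ ∘ₗ (LinearMap.toSpanSingleton T M m).restrictScalars A)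
  choose q hq using h1
  refine ⟨{ toFun := q, map_add' := ?_, map_smul' := ?_ }, ?_⟩
  · exact fun m m' => hl.eq_of_forall fun t => by simp only [smul_add, map_add, hq]
  · exact fun r m => hl.eq_of_forall fun t => by
      rw [hq, RingHom.id_apply, smul_smul, smul_smul, hq]
  · intro m
    simpa using hq m 1

variable [IsScalarTower A T Ω]

/-- As `T` is integral over the domain `A`, the nonzerodivisor `x` divides the image of some nonzero
`p` in `A`, namely a coefficient of an integral equation. So `x • w = 0` forces `p • lam (t • w) =
0` for all `t`. -/
theorem isSMulRegular [IsDomain A] [Module.Finite A T] {x : T} (hx : IsSMulRegular T x) :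
    IsSMulRegular Ω x := by
  obtain ⟨p, hp0, y, hy⟩ : ∃ p : A, p ≠ 0 ∧ ∃ y : T, y * x = algebraMap A T p := by
    obtain ⟨P, hP, hPx⟩ := Algebra.IsIntegral.isIntegral (R := A) x
    obtain ⟨i, hi, hmem⟩ := Ideal.exists_coeff_ne_zero_mem_comap_of_non_zero_divisor_root_mem
      (I := Ideal.span {x}) (f := algebraMap A T) (r := x)
      (fun {z} hz => hx (by simpa [mul_comm] using hz)) (Ideal.mem_span_singleton_self x)
      (p := P) hP.ne_zero hPx
    obtain ⟨y, hy⟩ := Ideal.mem_span_singleton'.mp (Ideal.mem_comap.mp hmem)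
    exact ⟨_, hi, y, hy⟩
  rw [isSMulRegular_iff_right_eq_zero_of_smul]
  intro w hw
  refine hl.eq_zero w fun t => ?_
  have : p • lam (t • w) = 0 := by
    rw [← map_smul, ← algebraMap_smul T p, ← hy, smul_smul,
      show y * x * t = (y * t) * x by ring, mul_smul, hw, smul_zero, map_zero]
  exact (smul_eq_zero.mp this).resolve_left hp0

/-- Projectivity of `M₃` splits the sequence over `A`. Then `lam ∘ φ` extends `A`-linearly along the
retraction, and the perfect form turns the extension into a `T`-linear map. -/
theorem exists_extension {M₁ M₂ M₃ : Type*} [AddCommGroup M₁] [AddCommGroup M₂]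
    [AddCommGroup M₃] [Module T M₁] [Module T M₂] [Module T M₃]
    [Module A M₁] [Module A M₂] [Module A M₃] [IsScalarTower A T M₁]
    [IsScalarTower A T M₂] [IsScalarTower A T M₃] [Module.Projective A M₃]
    {g : M₁ →ₗ[T] M₂} {h : M₂ →ₗ[T] M₃}
    (hg : Function.Injective g) (hgh : Function.Exact g h) (hh : Function.Surjective h)
    (φ : M₁ →ₗ[T] Ω) : ∃ ψ : M₂ →ₗ[T] Ω, ψ ∘ₗ g = φ := by
  obtain ⟨s, hs⟩ := Module.projective_lifting_property (h.restrictScalars A) LinearMap.id hh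
  have hex : Function.Exact (g.restrictScalars A) (h.restrictScalars A) := hgh
  have hiff : (Function.Injective (g.restrictScalars A) ∧
      ∃ l, (h.restrictScalars A) ∘ₗ l = LinearMap.id) ↔
      (Function.Surjective (h.restrictScalars A) ∧
        ∃ l, l ∘ₗ (g.restrictScalars A) = LinearMap.id) := hex.split_tfae'.out 0 1
  obtain ⟨-, l, hlg⟩ := hiff.mp ⟨hg, s, hs⟩
  obtain ⟨ψ, hψ⟩ := hl.exists_hom ((lam ∘ₗ φ.restrictScalars A) ∘ₗ l)
  refine ⟨ψ, hl.hom_ext fun m => ?_⟩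
  rw [LinearMap.comp_apply, hψ]
  have := LinearMap.congr_fun hlg m
  simp only [LinearMap.comp_apply, LinearMap.restrictScalars_apply, LinearMap.id_apply] at this ⊢
  rw [this]

/-- The obstruction to lifting `ψ` is the pullback extension `0 → Ω → P → M → 0`, whose first map is
multiplication by `x`. Extending the identity of `Ω` to `P` splits it. -/
theorem exists_lift_modElt [Module.Projective A M] {x : T} (hx : IsSMulRegular Ω x)
    (ψ : M →ₗ[T] ModElt x Ω) : ∃ φ : M →ₗ[T] Ω, ∀ m, toModElt x (φ m) = ψ m := by
  let P : Submodule T (M × Ω) := LinearMap.ker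
    (ψ ∘ₗ LinearMap.fst T M Ω - Submodule.mkQ _ ∘ₗ LinearMap.snd T M Ω)
  have hP : ∀ p : M × Ω, p ∈ P ↔ ψ p.1 = toModElt x p.2 := fun p => by
    rw [LinearMap.mem_ker, LinearMap.sub_apply, sub_eq_zero]
    rfl
  let i : Ω →ₗ[T] P := LinearMap.codRestrict P (LinearMap.inr T M Ω ∘ₗ LinearMap.lsmul T Ω x)
    fun w => by
      rw [hP]
      simp only [LinearMap.comp_apply, LinearMap.inr_apply, map_zero]
      exact (toModElt_eq_zero_iff.mpr ⟨w, rfl⟩).symm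
  let q : P →ₗ[T] M := LinearMap.fst T M Ω ∘ₗ P.subtype
  have hi : ∀ w, ((i w : P) : M × Ω) = (0, x • w) := fun w => rfl
  obtain ⟨χ, hχ⟩ := hl.exists_extension (g := i) (h := q)
    (fun w w' h => hx (by simpa [hi] using congrArg (fun p : P => (p : M × Ω).2) h))
    (by
      intro p
      constructor
      · intro hp
        obtain ⟨⟨m, w⟩, hmem⟩ := p
        change m = 0 at hp
        subst hp
        rw [hP] at hmem
        simp only [map_zero] at hmem
        obtain ⟨v, hv⟩ := toModElt_eq_zero_iff.mp hmem.symm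
        exact ⟨v, Subtype.ext (by rw [hi, hv])⟩
      · rintro ⟨w, rfl⟩
        rfl)
    (fun m => by
      obtain ⟨w, hw⟩ := toModElt_surjective (ψ m)
      exact ⟨⟨(m, w), (hP _).mpr hw.symm⟩, rfl⟩) LinearMap.id
  have hχ' : ∀ w, χ (i w) = w := fun w => LinearMap.congr_fun hχ w
  -- Subtracting `x • χ p` cancels the ambiguity in the second coordinate, so the difference depends
  -- on the first coordinate only; it is the desired lift.
  have hwd : ∀ p p' : P, (p : M × Ω).1 = (p' : M × Ω).1 →
      (p : M × Ω).2 - x • χ p = (p' : M × Ω).2 - x • χ p' := by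
    intro p p' hpp
    obtain ⟨v, hv⟩ : ∃ v, i v = p - p' := by
      have hmem := (hP _).mp (p - p').2
      have h0 : ((p - p' : P) : M × Ω).1 = 0 := by simp [hpp]
      rw [h0, map_zero] at hmem
      obtain ⟨v, hv⟩ := toModElt_eq_zero_iff.mp hmem.symm
      exact ⟨v, Subtype.ext (Prod.ext h0.symm hv)⟩
    have h2 : x • v = (p : M × Ω).2 - (p' : M × Ω).2 := by
      simpa [hi] using congrArg (fun p : P => (p : M × Ω).2) hv
    have h3 : v = χ p - χ p' := by rw [← map_sub, ← hv, hχ']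
    rw [h3, smul_sub] at h2
    rw [sub_eq_sub_iff_sub_eq_sub, ← h2]
  have hex : ∀ m : M, ∃ p : P, (p : M × Ω).1 = m := fun m => by
    obtain ⟨w, hw⟩ := toModElt_surjective (ψ m)
    exact ⟨⟨(m, w), (hP _).mpr hw.symm⟩, rfl⟩
  choose s hs using hex
  refine ⟨{ toFun := fun m => (s m : M × Ω).2 - x • χ (s m), map_add' := ?_, map_smul' := ?_ }, ?_⟩
  · intro m m'
    rw [hwd (s (m + m')) (s m + s m') (by simp [hs])]
    simp only [map_add, smul_add, Submodule.coe_add, Prod.snd_add]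
    abel
  · intro r m
    rw [hwd (s (r • m)) (r • s m) (by simp [hs])]
    simp only [map_smul, Submodule.coe_smul, Prod.smul_snd, RingHom.id_apply, smul_sub]
    rw [smul_comm]
  · intro m
    rw [← hs m, (hP _).mp (s m).2, hs m]
    exact toModElt_eq_iff.mpr ⟨-χ (s m), by simp⟩

/-- Composition with a perfect form identifies `Hom_T(M, Ω)` with `Hom_A(M, A)`. -/
noncomputable def homEquiv : (M →ₗ[T] Ω) ≃ₗ[A] (M →ₗ[A] A) :=
  LinearEquiv.ofBijective
    { toFun := fun φ => lam ∘ₗ φ.restrictScalars A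
      map_add' := fun φ ψ => by ext; simp
      map_smul' := fun a φ => by ext; simp }
    ⟨fun _ _ h => hl.hom_ext fun m => LinearMap.congr_fun h m,
      fun μ => (hl.exists_hom μ).imp fun _ hφ => LinearMap.ext hφ⟩

/-- Under `homEquiv` this is the reflexivity of finite projective `A`-modules. -/
theorem bijective_eval [Module.Finite A M] [Module.Projective A M] :
    Function.Bijective (LinearMap.applyₗ : M →ₗ[T] (M →ₗ[T] Ω) →ₗ[T] Ω) := by
  constructor
  · rw [injective_iff_map_eq_zero]
    intro m hm
    refine (Module.forall_dual_apply_eq_zero_iff A m).mp fun μ => ?_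
    obtain ⟨φ, hφ⟩ := hl.exists_hom μ
    rw [← hφ]
    have := LinearMap.congr_fun hm φ
    rw [LinearMap.applyₗ_apply_apply, LinearMap.zero_apply] at this
    rw [this, map_zero]
  · intro Φ
    obtain ⟨m, hm⟩ := (Module.bijective_dual_eval A M).2
      (lam ∘ₗ Φ.restrictScalars A ∘ₗ (hl.homEquiv (M := M)).symm.toLinearMap)
    have key : ∀ φ : M →ₗ[T] Ω, lam (Φ φ) = lam (φ m) := fun φ => by
      have := LinearMap.congr_fun hm (hl.homEquiv φ)
      simp only [LinearMap.comp_apply, LinearMap.restrictScalars_apply, LinearEquiv.coe_coe,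
        LinearEquiv.symm_apply_apply] at this
      exact this.symm
    refine ⟨m, LinearMap.ext fun φ => hl.eq_of_forall fun t => ?_⟩
    rw [LinearMap.applyₗ_apply_apply, ← LinearMap.smul_apply, ← key (t • φ), map_smul]

end IsPerfectForm

end PerfectForm

end GradedDuality

namespace GradedDuality

open Polynomial

/-! ### The polynomial ring in one variable of degree `e` -/

section PolyGrading

variable {K : Type*} [Field K] {e : ℤ}

variable (K) in
/-- The grading of `K[X]` for which `X` has degree `e`. -/
def polyGrading (e : ℤ) : ℤ → AddSubgroup K[X] := fun k =>
  { carrier := {p | ∀ i, p.coeff i ≠ 0 → (i : ℤ) * e = k}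
    zero_mem' := fun i hi => absurd (coeff_zero i) hi
    add_mem' := fun {p q} hp hq i hi => by
      by_cases h : p.coeff i = 0
      · exact hq i fun h' => hi (by rw [coeff_add, h, h', add_zero])
      · exact hp i h
    neg_mem' := fun {p} hp i hi => hp i fun h => hi (by rw [coeff_neg, h, neg_zero]) }

theorem monomial_mem_polyGrading (e : ℤ) (i : ℕ) (c : K) :
    monomial i c ∈ polyGrading K e (i * e) := by
  intro j hj
  rw [coeff_monomial] at hj
  have : i = j := by by_contra h; exact hj (if_neg h)
  rw [this]

theorem polyGrading_isGradedModule (he : 0 < e) :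
    IsGradedModule (polyGrading K e) (polyGrading K e) where
  isInternal := by
    classical
    let p : ℤ → K[X] →+ K[X] := fun k =>
      if h : ∃ i : ℕ, (i : ℤ) * e = k then
        ((monomial h.choose).comp (lcoeff K h.choose)).toAddMonoidHom else 0
    have hinj : ∀ {i j : ℕ}, (i : ℤ) * e = j * e → i = j := fun h => by
      exact_mod_cast mul_right_cancel₀ he.ne' h
    have hp : ∀ (i : ℕ) (k : ℤ), (i : ℤ) * e = k → ∀ q, p k q = monomial i (q.coeff i) := by
      intro i k hik q
      have h : ∃ i : ℕ, (i : ℤ) * e = k := ⟨i, hik⟩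
      have h2 : h.choose = i := hinj (h.choose_spec.trans hik.symm)
      simp only [p, dif_pos h]
      rw [h2]
      rfl
    have hp' : ∀ k : ℤ, (¬ ∃ i : ℕ, (i : ℤ) * e = k) → ∀ q, p k q = 0 := by
      intro k hk q
      simp only [p, dif_neg hk]
      rfl
    refine isInternal_of_components p ?_ ?_ ?_ ?_
    · intro k q
      by_cases h : ∃ i : ℕ, (i : ℤ) * e = k
      · obtain ⟨i, rfl⟩ := h
        rw [hp i _ rfl]
        exact monomial_mem_polyGrading e i _
      · rw [hp' k h]
        exact zero_mem _
    · intro k q hq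
      by_cases h : ∃ i : ℕ, (i : ℤ) * e = k
      · obtain ⟨i, rfl⟩ := h
        rw [hp i _ rfl]
        ext j
        rw [coeff_monomial]
        split_ifs with hij
        · rw [hij]
        · by_contra h0
          exact hij (hinj (hq j (Ne.symm h0))).symm
      · rw [hp' k h]
        ext j
        by_contra h0
        exact h ⟨j, hq j (Ne.symm h0)⟩
    · intro j k hjk q hq
      by_cases h : ∃ i : ℕ, (i : ℤ) * e = k
      · obtain ⟨i, hi⟩ := h
        rw [hp i _ hi]
        by_cases h0 : q.coeff i = 0
        · rw [h0, map_zero]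
        · exact absurd ((hq i h0).symm.trans hi) hjk
      · exact hp' k h q
    · intro q
      refine ⟨q.support.image fun i : ℕ => (i : ℤ) * e, ?_⟩
      rw [Finset.sum_image fun i _ j _ h => hinj h]
      rw [Finset.sum_congr rfl fun i _ => hp i _ rfl q]
      exact q.as_sum_support
  smul_mem i j r m hr hm k hk := by
    rw [smul_eq_mul, coeff_mul] at hk
    obtain ⟨⟨a, b⟩, hab, h0⟩ := Finset.exists_ne_zero_of_sum_ne_zero hk
    rw [Finset.HasAntidiagonal.mem_antidiagonal] at hab
    rw [← hr a (left_ne_zero_of_mul h0), ← hm b (right_ne_zero_of_mul h0), ← hab]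
    push_cast
    ring

theorem coeff_zero_of_mem_polyGrading {k : ℤ} (hk : k ≠ 0) {p : K[X]}
    (hp : p ∈ polyGrading K e k) : p.coeff 0 = 0 := by
  by_contra h
  exact hk (by simpa using (hp 0 h).symm)

theorem polyGrading_of_neg (he : 0 < e) {k : ℤ} (hk : k < 0) {p : K[X]}
    (hp : p ∈ polyGrading K e k) : p = 0 := by
  ext i
  by_contra h
  have := hp i h
  have h2 : 0 ≤ (i : ℤ) * e := by positivity
  omega

theorem coeff_zero_component_zero (he : 0 < e) (p : K[X]) :
    (component (polyGrading_isGradedModule he).isInternal 0 p).coeff 0 = p.coeff 0 := by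
  induction p using homogeneous_induction (polyGrading_isGradedModule he).isInternal with
  | zero => simp
  | add p q hp hq => rw [map_add, coeff_add, coeff_add, hp, hq]
  | homogeneous k p hp =>
    by_cases hk : k = 0
    · subst hk
      rw [component_of_mem _ hp]
    · rw [component_of_mem_ne _ hk hp, coeff_zero_of_mem_polyGrading hk hp, coeff_zero]

/-- Nakayama produces annihilators of the form `1 + X * s`. Since `X * s` only raises degrees, such
a factor does not affect the component in the degree of `q`. -/
theorem component_one_add_X_mul_mul (he : 0 < e) {k : ℤ} {q : K[X]} (hq : q ∈ polyGrading K e k)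
    (s : K[X]) : component (polyGrading_isGradedModule he).isInternal k ((1 + X * s) * q) = q := by
  have hX : (X : K[X]) ∈ polyGrading K e e := by
    simpa [monomial_one_one_eq_X] using monomial_mem_polyGrading e 1 (1 : K)
  have h0 : component (polyGrading_isGradedModule he).isInternal k (X * s * q) = 0 := by
    induction s using homogeneous_induction (polyGrading_isGradedModule he).isInternal with
    | zero => simp
    | add s t hs ht => rw [mul_add, add_mul, map_add, hs, ht, add_zero]
    | homogeneous i s hs =>
      rcases lt_or_ge i 0 with hi | hi
      · rw [polyGrading_of_neg he hi hs]; simp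
      · have h1 := (polyGrading_isGradedModule he).smul_mem _ _ _ _ hX
          ((polyGrading_isGradedModule he).smul_mem _ _ _ _ hs hq)
        rw [smul_eq_mul, smul_eq_mul, ← mul_assoc] at h1
        exact component_of_mem_ne _ (by omega) h1
  rw [add_mul, one_mul, map_add, h0, add_zero, component_of_mem _ hq]

end PolyGrading

theorem IsGradedModule.component_apply {R : Type*} [CommRing R] {𝒜 : ℤ → AddSubgroup R}
    {M : Type*} [AddCommGroup M] [Module R M] {ℳ : ℤ → AddSubgroup M}
    {N : Type*} [AddCommGroup N] [Module R N] {𝒩 : ℤ → AddSubgroup N}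
    (hM : IsGradedModule 𝒜 ℳ) (hN : IsGradedModule 𝒜 𝒩) {k : ℤ} {φ : M →ₗ[R] N}
    (hφ : φ ∈ homGrading (R := R) ℳ 𝒩 k) (j : ℤ) (m : M) :
    φ (component hM.isInternal j m) = component hN.isInternal (j + k) (φ m) := by
  induction m using homogeneous_induction hM.isInternal with
  | zero => simp
  | add m m' hm hm' => simp only [map_add, hm, hm']
  | homogeneous i m hm =>
    by_cases hij : i = j
    · subst hij
      rw [component_of_mem _ hm, component_of_mem _ (hφ i m hm)]
    · rw [component_of_mem_ne _ hij hm, component_of_mem_ne _ (by simpa using hij) (hφ i m hm),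
        map_zero]

/-! ### Graded modules over a graded algebra, with a homogeneous parameter -/

section Parameter

variable {K : Type*} [Field K] {T : Type*} [CommRing T] [Algebra K T] [Algebra K[X] T]
  [IsScalarTower K K[X] T] {𝒜 : ℤ → AddSubgroup T} {e : ℤ}
variable {M : Type*} [AddCommGroup M] [Module T M] [Module K[X] M] [IsScalarTower K[X] T M]
  {ℳ : ℤ → AddSubgroup M}

theorem pow_mem_grading {T : Type*} [CommRing T] {𝒜 : ℤ → AddSubgroup T}
    (hA : IsGradedModule 𝒜 𝒜) (h1 : (1 : T) ∈ 𝒜 0) {x : T} (hx : x ∈ 𝒜 e) (i : ℕ) : x ^ i ∈ 𝒜 (i * e) := by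
  induction i with
  | zero => simpa using h1
  | succ i ih =>
    have := hA.smul_mem _ _ _ _ ih hx
    rw [smul_eq_mul, ← pow_succ] at this
    convert! this using 2
    push_cast
    ring

theorem algebraMap_mem_grading (hA : IsGradedModule 𝒜 𝒜) (h0 : ∀ c : K, algebraMap K T c ∈ 𝒜 0)
    (hx : algebraMap K[X] T X ∈ 𝒜 e) {k : ℤ} {p : K[X]} (hp : p ∈ polyGrading K e k) :
    algebraMap K[X] T p ∈ 𝒜 k := by
  rw [p.as_sum_support_C_mul_X_pow, map_sum]
  refine sum_mem fun i hi => ?_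
  rw [← hp i (mem_support_iff.mp hi), map_mul, map_pow, ← zero_add ((i : ℤ) * e)]
  refine hA.smul_mem _ _ _ _ ?_ (pow_mem_grading hA (by simpa using h0 1) hx i)
  rw [← algebraMap_eq, ← IsScalarTower.algebraMap_apply]
  exact h0 _

theorem IsGradedModule.polynomial (hM : IsGradedModule 𝒜 ℳ) (hA : IsGradedModule 𝒜 𝒜)
    (h0 : ∀ c : K, algebraMap K T c ∈ 𝒜 0) (hx : algebraMap K[X] T X ∈ 𝒜 e) : IsGradedModule (polyGrading K e) ℳ where
  isInternal := hM.isInternal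
  smul_mem i j p m hp hm := by
    rw [← algebraMap_smul T p m]
    exact hM.smul_mem _ _ _ _ (algebraMap_mem_grading hA h0 hx hp) hm

/-- In the highest degree of `p • m` only the leading term of `p` and the top component of `m` meet,
and a power of `X` cannot kill the latter. -/
theorem eq_zero_of_smul_eq_zero (he : 0 < e) {M : Type*} [AddCommGroup M] [Module K[X] M]
    {ℳ : ℤ → AddSubgroup M} (hM : IsGradedModule (polyGrading K e) ℳ)
    (hX : IsSMulRegular M (X : K[X])) {p : K[X]} (hp : p ≠ 0) {m : M} (hpm : p • m = 0) :
    m = 0 := by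
  classical
  by_contra hm
  obtain ⟨F, hF0, hF⟩ := exists_sum_component hM.isInternal m
  let G := F.filter fun k => component hM.isInternal k m ≠ 0
  have hG : G.Nonempty := by
    by_contra hG
    rw [Finset.not_nonempty_iff_eq_empty, Finset.filter_eq_empty_iff] at hG
    refine hm (hF.trans (Finset.sum_eq_zero fun k hk => not_not.mp (hG hk)))
  let J := G.max' hG
  have hJ : component hM.isInternal J m ≠ 0 := (Finset.mem_filter.mp (G.max'_mem hG)).2
  have hJ' : ∀ k, J < k → component hM.isInternal k m = 0 := by
    intro k hk
    by_contra h
    have hkF : k ∈ F := by by_contra h'; exact h (hF0 k h')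
    have := G.le_max' k (Finset.mem_filter.mpr ⟨hkF, h⟩)
    exact absurd hk (not_lt.mpr this)
  have h1 : component hM.isInternal (p.natDegree * e + J) (p • m) =
      monomial p.natDegree p.leadingCoeff • component hM.isInternal J m := by
    have hsum : p • m = ∑ i ∈ Finset.range (p.natDegree + 1), monomial i (p.coeff i) • m := by
      rw [← Finset.sum_smul, ← p.as_sum_range]
    rw [hsum, map_sum, Finset.sum_range_succ, Finset.sum_eq_zero, zero_add,
      hM.component_smul (monomial_mem_polyGrading e _ _), leadingCoeff]
    intro i hi
    rw [Finset.mem_range] at hi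
    have : (p.natDegree : ℤ) * e + J = i * e + (J + (p.natDegree - i) * e) := by ring
    rw [this, hM.component_smul (monomial_mem_polyGrading e _ _), hJ', smul_zero]
    have : (0 : ℤ) < (p.natDegree - i) := by omega
    have := mul_pos this he
    omega
  rw [hpm, map_zero, ← C_mul_X_pow_eq_monomial, mul_smul] at h1
  have h2 : (X : K[X]) ^ p.natDegree • component hM.isInternal J m = 0 := by
    have := congrArg (fun v => C (p.leadingCoeff)⁻¹ • v) h1
    simp only [smul_zero, smul_smul, ← C_mul, ← mul_assoc] at this
    rw [inv_mul_cancel₀ (leadingCoeff_ne_zero.mpr hp), C_1, one_mul] at this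
    exact this.symm
  exact hJ ((isSMulRegular_iff_right_eq_zero_of_smul.mp (hX.pow _)) _ h2)

/-- A finitely generated torsion-free module over a principal ideal domain is free. -/
theorem free_of_isSMulRegular (he : 0 < e) {M : Type*} [AddCommGroup M] [Module K[X] M]
    {ℳ : ℤ → AddSubgroup M} (hM : IsGradedModule (polyGrading K e) ℳ)
    (hX : IsSMulRegular M (X : K[X])) [Module.Finite K[X] M] : Module.Free K[X] M := by
  have : Module.IsTorsionFree K[X] M := Module.isTorsionFree_iff_smul_eq_zero.mpr
    fun p m h => by
      by_contra! h'
      exact h'.2 (eq_zero_of_smul_eq_zero he hM hX h'.1 h)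
  infer_instance

end Parameter

end GradedDuality

namespace GradedDuality

open Polynomial

/-! ### Lifting the duality modulo `x` to a perfect form over `K[X]`. -/

section ExistsForm

variable {K : Type*} [Field K] {T : Type*} [CommRing T] [Algebra K T] [Algebra K[X] T]
  [IsScalarTower K K[X] T] [Module.Finite K[X] T] {𝒜 : ℤ → AddSubgroup T} {e : ℤ}
variable {Ω : Type*} [AddCommGroup Ω] [Module T Ω] [Module K[X] Ω] [IsScalarTower K[X] T Ω]
  [Module.Finite K[X] Ω] {𝒲 : ℤ → AddSubgroup Ω}

/-- The map `Ω → Hom_A(T, A)` attached to a form `Ω → A`. -/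
noncomputable def formHom {A : Type*} [CommRing A] {T : Type*} [CommRing T] [Algebra A T]
    {Ω : Type*} [AddCommGroup Ω] [Module T Ω] [Module A Ω] [IsScalarTower A T Ω]
    (lam : Ω →ₗ[A] A) : Ω →ₗ[A] (T →ₗ[A] A) :=
  LinearMap.mk₂ A (fun w t => lam (t • w)) (fun w w' t => by rw [smul_add, map_add])
    (fun a w t => by rw [smul_comm, map_smul]) (fun w t t' => by rw [add_smul, map_add])
    (fun a w t => by rw [smul_assoc, map_smul])

theorem formHom_apply {A : Type*} [CommRing A] {T : Type*} [CommRing T] [Algebra A T]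
    {Ω : Type*} [AddCommGroup Ω] [Module T Ω] [Module A Ω] [IsScalarTower A T Ω]
    (lam : Ω →ₗ[A] A) (w : Ω) (t : T) : formHom lam w t = lam (t • w) := rfl

theorem exists_one_add_X_mul {r : K[X]} (hr : r - 1 ∈ Ideal.span {(X : K[X])}) :
    ∃ s, r = 1 + X * s := by
  obtain ⟨s, hs⟩ := Ideal.mem_span_singleton'.mp hr
  exact ⟨s, by rw [mul_comm X s, hs]; ring⟩

/-- Perfectness modulo `X` implies perfectness. The kernel and the cokernel of `Ω → Hom_A(T, A)`
both equal `X` times themselves, so Nakayama kills each by some `1 + X * s`. The kernel is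
torsion-free, hence zero; the cokernel is treated degree by degree. -/
theorem isPerfectForm_of_coeff_zero (hA : IsGradedModule 𝒜 𝒜) (he : 0 < e)
    (h0 : ∀ c : K, algebraMap K T c ∈ 𝒜 0) (hx : algebraMap K[X] T X ∈ 𝒜 e)
    (hW : IsGradedModule 𝒜 𝒲) (hX : IsSMulRegular Ω (X : K[X]))
    {lam : Ω →ₗ[K[X]] K[X]} {d : ℤ} (hlam : lam ∈ homGrading (R := K[X]) 𝒲 (polyGrading K e) d)
    (hinj : ∀ w : Ω, (∀ t : T, (lam (t • w)).coeff 0 = 0) → ∃ w', (X : K[X]) • w' = w)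
    (hsurj : ∀ μ : T →ₗ[K[X]] K[X], ∃ w : Ω, ∀ t : T, (μ t - lam (t • w)).coeff 0 = 0) :
    IsPerfectForm T lam := by
  have hW' := hW.polynomial hA h0 hx
  have hA' := hA.polynomial hA h0 hx
  have hP := polyGrading_isGradedModule (K := K) he
  have hker : LinearMap.ker (formHom (T := T) lam) ≤
      Ideal.span {(X : K[X])} • LinearMap.ker (formHom (T := T) lam) := by
    intro w hw
    rw [Submodule.ideal_span_singleton_smul, Submodule.mem_smul_pointwise_iff_exists]
    obtain ⟨w', rfl⟩ := hinj w fun t => by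
      rw [← formHom_apply, LinearMap.mem_ker.mp hw, LinearMap.zero_apply, coeff_zero]
    refine ⟨w', ?_, rfl⟩
    rw [LinearMap.mem_ker, map_smul] at hw
    rw [LinearMap.mem_ker]
    ext1 t
    have := LinearMap.congr_fun hw t
    rw [LinearMap.smul_apply, smul_eq_mul, LinearMap.zero_apply] at this
    exact (mul_eq_zero.mp this).resolve_left X_ne_zero
  have hrange : (⊤ : Submodule K[X] ((T →ₗ[K[X]] K[X]) ⧸ LinearMap.range (formHom (T := T) lam))) ≤
      Ideal.span {(X : K[X])} • ⊤ := by
    rintro q -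
    obtain ⟨μ, rfl⟩ := Submodule.Quotient.mk_surjective _ q
    obtain ⟨w, hw⟩ := hsurj μ
    rw [Submodule.ideal_span_singleton_smul, Submodule.mem_smul_pointwise_iff_exists]
    have hdiv : ∀ t, X * (μ t - lam (t • w)).divX = μ t - lam (t • w) := fun t => by
      conv_rhs => rw [← X_mul_divX_add (μ t - lam (t • w)), hw t, C_0, add_zero]
    let ν : T →ₗ[K[X]] K[X] :=
      { toFun := fun t => (μ t - lam (t • w)).divX
        map_add' := fun t t' => mul_left_cancel₀ X_ne_zero (by
          rw [mul_add, hdiv, hdiv, hdiv, map_add, add_smul, map_add]; ring)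
        map_smul' := fun a t => mul_left_cancel₀ (X_ne_zero (R := K)) (by
          rw [RingHom.id_apply, mul_smul_comm, hdiv, hdiv, map_smul, smul_assoc, map_smul,
            smul_sub]) }
    refine ⟨Submodule.Quotient.mk ν, trivial, ?_⟩
    rw [← Submodule.Quotient.mk_smul, Submodule.Quotient.eq]
    refine ⟨-w, ?_⟩
    ext1 t
    rw [formHom_apply, smul_neg, map_neg, LinearMap.sub_apply, LinearMap.smul_apply, smul_eq_mul]
    change _ = X * (μ t - lam (t • w)).divX - μ t
    rw [hdiv]
    ring
  constructor
  · intro w hw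
    obtain ⟨r, hr, hr0⟩ := Submodule.exists_sub_one_mem_and_smul_eq_zero_of_fg_of_le_smul _ _
      (IsNoetherian.noetherian (LinearMap.ker (formHom (T := T) lam))) hker
    obtain ⟨s, rfl⟩ := exists_one_add_X_mul hr
    refine eq_zero_of_smul_eq_zero he hW' hX (fun h => ?_)
      (hr0 w (LinearMap.mem_ker.mpr (LinearMap.ext hw)))
    simpa using congrArg (fun p : K[X] => p.coeff 0) h
  · have : Module.Finite K[X] (T →ₗ[K[X]] K[X]) := finite_linearMap _ _
    obtain ⟨r, hr, hr0⟩ := Submodule.exists_sub_one_mem_and_smul_eq_zero_of_fg_of_le_smul _ _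
      (Module.Finite.fg_top) hrange
    obtain ⟨s, rfl⟩ := exists_one_add_X_mul hr
    suffices H : ∀ μ : T →ₗ[K[X]] K[X], μ ∈ LinearMap.range (formHom (T := T) lam) by
      intro μ
      obtain ⟨w, hw⟩ := H μ
      exact ⟨w, fun t => LinearMap.congr_fun hw t⟩
    intro μ
    induction μ using homogeneous_induction (homGrading_isInternal hP hA' hP) with
    | zero => exact zero_mem _
    | add μ ν hμ hν => exact add_mem hμ hν
    | homogeneous k μ hμ =>
      obtain ⟨w, hw⟩ : (1 + X * s) • μ ∈ LinearMap.range (formHom (T := T) lam) := by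
        have := hr0 (Submodule.Quotient.mk μ) trivial
        rwa [← Submodule.Quotient.mk_smul, Submodule.Quotient.mk_eq_zero] at this
      -- As `lam` has degree `d`, this component of `w` represents the part of degree `k` of `(1 + X
      -- * s) • μ`, which is `μ`.
      refine ⟨component hW.isInternal (k - d) w, ?_⟩
      rw [← sub_eq_zero]
      refine linearMap_eq_zero_of_homogeneous hA' fun j t ht => ?_
      rw [LinearMap.sub_apply, sub_eq_zero, formHom_apply, ← hW.component_smul ht,
        hW'.component_apply hP hlam, show j + (k - d) + d = j + k by ring, ← formHom_apply, hw,
        LinearMap.smul_apply, smul_eq_mul, component_one_add_X_mul_mul he (hμ j t ht)]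

/-- The functional `w ↦ ε w 1` recovers all of `ε`. It is lifted to an `A`-linear form on the free
module `Ω` with this functional as constant coefficient. -/
theorem exists_isPerfectForm (hA : IsGradedModule 𝒜 𝒜) (he : 0 < e)
    (h0 : ∀ c : K, algebraMap K T c ∈ 𝒜 0) {x : T} (hxX : algebraMap K[X] T X = x) (hx : x ∈ 𝒜 e)
    (hW : IsGradedModule 𝒜 𝒲) (hreg : IsSMulRegular Ω x)
    (ε : ModElt x Ω ≃+ Module.Dual K (T ⧸ Ideal.span {x}))
    (hε : ∀ (r : T) (w : ModElt x Ω) (a : T ⧸ Ideal.span {x}), ε (r • w) a = ε w (r • a))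
    (hεgr : ∀ (i j : ℤ) (w : Ω) (a : T), w ∈ 𝒲 i → a ∈ 𝒜 j → i + j ≠ e →
      ε (toModElt x w) (Ideal.Quotient.mk (Ideal.span {x}) a) = 0) :
    ∃ lam : Ω →ₗ[K[X]] K[X], IsPerfectForm T lam := by
  have hx' : algebraMap K[X] T X ∈ 𝒜 e := hxX ▸ hx
  have hW' := hW.polynomial hA h0 hx'
  have hP := polyGrading_isGradedModule (K := K) he
  have hXx : ∀ w : Ω, (X : K[X]) • w = x • w := fun w => by rw [← hxX, algebraMap_smul]
  have hX : IsSMulRegular Ω (X : K[X]) := fun w w' h => hreg (by simpa only [hXx] using h)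
  have hfree : Module.Free K[X] Ω := free_of_isSMulRegular he hW' hX
  have halg : ∀ p : K[X], Ideal.Quotient.mk (Ideal.span {x}) (algebraMap K[X] T p) =
      algebraMap K (T ⧸ Ideal.span {x}) (p.coeff 0) := by
    intro p
    conv_lhs => rw [← X_mul_divX_add p, map_add, map_add, map_mul, hxX, map_mul,
      Ideal.Quotient.eq_zero_iff_mem.mpr (Ideal.mem_span_singleton_self x), zero_mul, zero_add,
      ← algebraMap_eq, ← IsScalarTower.algebraMap_apply]
    rfl
  let β : Ω →+ K :=
    { toFun := fun w => ε (toModElt x w) 1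
      map_zero' := by
        change ε 0 1 = 0
        rw [map_zero, LinearMap.zero_apply]
      map_add' := fun w w' => by
        change ε (toModElt x w + toModElt x w') 1 = _
        rw [map_add, LinearMap.add_apply] }
  have hβ : ∀ (t : T) (w : Ω), β (t • w) = ε (toModElt x w) (Ideal.Quotient.mk _ t) := by
    intro t w
    change ε (t • toModElt x w) 1 = _
    rw [hε, Algebra.smul_def, mul_one]
    rfl
  have hβp : ∀ (p : K[X]) (w : Ω), β (p • w) = p.coeff 0 * β w := by
    intro p w
    rw [← algebraMap_smul T p w, hβ, halg, Algebra.algebraMap_eq_smul_one, map_smul, smul_eq_mul]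
    rfl
  let b := Module.Free.chooseBasis K[X] Ω
  let lam' : Ω →ₗ[K[X]] K[X] := b.constr K[X] fun i => C (β (b i))
  have hlam' : ∀ w, (lam' w).coeff 0 = β w := by
    intro w
    rw [← b.sum_repr w, map_sum, map_sum, finsetSum_coeff]
    refine Finset.sum_congr rfl fun i _ => ?_
    rw [map_smul, hβp, smul_eq_mul, mul_coeff_zero, Module.Basis.constr_basis, coeff_C_zero]
  -- The chosen basis need not be homogeneous, so `lam'` need not be either. Its component of degree
  -- `-e` keeps the constant coefficient, because `β` vanishes outside degree `e`.
  let lam := homComponent hP hW' hP (-e) lam'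
  have hlam : ∀ w, (lam w).coeff 0 = β w := by
    intro w
    induction w using homogeneous_induction hW.isInternal with
    | zero => simp
    | add w w' h h' => rw [map_add, map_add, coeff_add, h, h']
    | homogeneous i w hw =>
      simp only [lam]
      rw [homComponent_of_mem hP hW' hP (-e) lam' hw]
      by_cases hi : i = e
      · rw [hi, add_neg_cancel, coeff_zero_component_zero he, hlam']
      · rw [coeff_zero_of_mem_polyGrading (fun h => hi (by omega))
          (component_mem hP.isInternal (i + -e) (lam' w))]
        exact (hεgr i 0 w 1 hw (by simpa using h0 1) (by omega)).symm
  refine ⟨lam, isPerfectForm_of_coeff_zero hA he h0 hx' hW hX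
    (homComponent_mem hP hW' hP (-e) lam') ?_ ?_⟩
  · intro w hw
    have : toModElt x w = 0 := by
      rw [← map_eq_zero_iff ε ε.injective]
      refine LinearMap.ext fun a => ?_
      obtain ⟨t, rfl⟩ := Ideal.Quotient.mk_surjective a
      rw [← hβ, ← hlam, hw, LinearMap.zero_apply]
    obtain ⟨w', hw'⟩ := toModElt_eq_zero_iff.mp this
    exact ⟨w', by rw [hXx, hw']⟩
  · intro μ
    -- The constant coefficient of `μ` descends to `T/xT` because `μ (x * s) = X * μ s`.
    let θ : Module.Dual K (T ⧸ Ideal.span {x}) :=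
      Submodule.liftQ ((Ideal.span {x} : Ideal T).restrictScalars K)
        (Polynomial.lcoeff K 0 ∘ₗ μ.restrictScalars K) (by
          intro t ht
          obtain ⟨s, rfl⟩ := Ideal.mem_span_singleton'.mp ht
          rw [LinearMap.mem_ker]
          change (μ (s * x)).coeff 0 = 0
          rw [mul_comm, ← hxX, ← Algebra.smul_def, map_smul, smul_eq_mul, coeff_X_mul_zero])
    have hθ : ∀ t, θ (Ideal.Quotient.mk _ t) = (μ t).coeff 0 := fun t => rfl
    obtain ⟨w, hw⟩ := toModElt_surjective (ε.symm θ)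
    refine ⟨w, fun t => ?_⟩
    rw [coeff_sub, hlam, hβ, hw, AddEquiv.apply_symm_apply, hθ, sub_self]

end ExistsForm

end GradedDuality

namespace GradedDuality

/-! ### Regular sequences modulo an ideal -/

section RegularModIdeal

variable {R : Type*} [CommRing R]

/-- `g` is a nonzerodivisor modulo the ideal `Q`. -/
def RegularMod (Q : Ideal R) (g : R) : Prop := ∀ s, g * s ∈ Q → s ∈ Q

/-- The list is a (weakly) regular sequence modulo the ideal `Q`. -/
def RegularSeqMod (Q : Ideal R) : List R → Prop
  | [] => True
  | g :: gs => RegularMod Q g ∧ RegularSeqMod (Q ⊔ Ideal.span {g}) gs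

/-- The ideals `Q + (g₁, …, gᵢ)`, for all initial segments of the list. -/
def partialIdeals (Q : Ideal R) : List R → List (Ideal R)
  | [] => [Q]
  | g :: gs => Q :: partialIdeals (Q ⊔ Ideal.span {g}) gs

theorem mem_sup_span_singleton {Q : Ideal R} {g s : R} :
    s ∈ Q ⊔ Ideal.span {g} ↔ ∃ q ∈ Q, ∃ a, s = q + g * a := by
  rw [Submodule.mem_sup]
  constructor
  · rintro ⟨q, hq, z, hz, rfl⟩
    obtain ⟨a, rfl⟩ := Ideal.mem_span_singleton'.mp hz
    exact ⟨q, hq, a, by rw [mul_comm]⟩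
  · rintro ⟨q, hq, a, rfl⟩
    exact ⟨q, hq, g * a, Ideal.mem_span_singleton'.mpr ⟨a, mul_comm _ _⟩, rfl⟩

theorem regularMod_iff_isSMulRegular {Q : Ideal R} {g : R} :
    RegularMod Q g ↔ IsSMulRegular (R ⧸ Q) g := by
  rw [isSMulRegular_iff_right_eq_zero_of_smul]
  constructor
  · intro h a ha
    obtain ⟨s, rfl⟩ := Ideal.Quotient.mk_surjective a
    refine Ideal.Quotient.eq_zero_iff_mem.mpr (h s (Ideal.Quotient.eq_zero_iff_mem.mp ?_))
    rwa [← smul_eq_mul]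
  · intro h s hs
    exact Ideal.Quotient.eq_zero_iff_mem.mp (h (Ideal.Quotient.mk Q s)
      (Ideal.Quotient.eq_zero_iff_mem.mpr hs))

theorem RegularMod.pow {Q : Ideal R} {g : R} (h : RegularMod Q g) (N : ℕ) :
    RegularMod Q (g ^ N) := by
  induction N with
  | zero => intro s hs; simpa using hs
  | succ N ih =>
    intro s hs
    rw [pow_succ', mul_assoc] at hs
    exact ih s (h _ hs)

theorem RegularMod.swap {Q : Ideal R} {x y : R} (hx : RegularMod Q x)
    (hy : RegularMod (Q ⊔ Ideal.span {x}) y) : RegularMod (Q ⊔ Ideal.span {y}) x := by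
  intro u hu
  obtain ⟨q, hq, v, hv⟩ := mem_sup_span_singleton.mp hu
  have h1 : y * v ∈ Q ⊔ Ideal.span {x} :=
    mem_sup_span_singleton.mpr ⟨-q, neg_mem hq, u, by rw [hv]; ring⟩
  obtain ⟨q', hq', w, rfl⟩ := mem_sup_span_singleton.mp (hy v h1)
  have h2 : x * (u - y * w) ∈ Q := by
    have : x * (u - y * w) = q + y * q' := by rw [mul_sub, hv]; ring
    rw [this]
    exact add_mem hq (Q.mul_mem_left y hq')
  exact mem_sup_span_singleton.mpr ⟨_, hx _ h2, w, by ring⟩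

theorem sup_ofList_append (Q : Ideal R) (gs hs : List R) :
    Q ⊔ Ideal.ofList (gs ++ hs) = (Q ⊔ Ideal.ofList gs) ⊔ Ideal.ofList hs := by
  rw [Ideal.ofList_append, sup_assoc]

theorem sup_ofList_cons (Q : Ideal R) (g : R) (gs : List R) :
    Q ⊔ Ideal.ofList (g :: gs) = (Q ⊔ Ideal.span {g}) ⊔ Ideal.ofList gs := by
  rw [Ideal.ofList_cons, sup_assoc]

theorem regularSeqMod_append_singleton {Q : Ideal R} {gs : List R} {g : R} :
    RegularSeqMod Q (gs ++ [g]) ↔ RegularSeqMod Q gs ∧ RegularMod (Q ⊔ Ideal.ofList gs) g := by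
  induction gs generalizing Q with
  | nil => simp [RegularSeqMod]
  | cons f gs ih => rw [List.cons_append, RegularSeqMod, RegularSeqMod, ih, sup_ofList_cons, and_assoc]

theorem last_mem_partialIdeals (Q : Ideal R) (gs : List R) :
    Q ⊔ Ideal.ofList gs ∈ partialIdeals Q gs := by
  induction gs generalizing Q with
  | nil => simp [partialIdeals]
  | cons g gs ih =>
    rw [partialIdeals, sup_ofList_cons]
    exact List.mem_cons_of_mem _ (ih _)

theorem head_mem_partialIdeals (Q : Ideal R) (gs : List R) : Q ∈ partialIdeals Q gs := by
  cases gs <;> simp [partialIdeals]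

/-- An element regular modulo all the partial ideals can be moved from the end of the sequence to
its front, by repeated use of `RegularMod.swap`. -/
theorem RegularSeqMod.sup {Q : Ideal R} {gs : List R} (h : RegularSeqMod Q gs) {y : R}
    (hy : ∀ J ∈ partialIdeals Q gs, RegularMod J y) :
    RegularSeqMod (Q ⊔ Ideal.span {y}) gs := by
  induction gs generalizing Q with
  | nil => trivial
  | cons g gs ih =>
    refine ⟨h.1.swap (hy _ (List.mem_cons_of_mem _ (head_mem_partialIdeals _ _))), ?_⟩
    rw [sup_right_comm]
    exact ih h.2 fun J hJ => hy J (List.mem_cons_of_mem _ hJ)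

theorem regularSeqMod_of_isWeaklyRegular {gs : List R} {Q : Ideal R}
    (h : ∀ i (hi : i < gs.length), RegularMod (Q ⊔ Ideal.ofList (gs.take i)) gs[i]) :
    RegularSeqMod Q gs := by
  induction gs generalizing Q with
  | nil => trivial
  | cons g gs ih =>
    refine ⟨?_, ih fun i hi => ?_⟩
    · have h1 := h 0 (by simp)
      rw [List.take_zero, Ideal.ofList_nil, sup_bot_eq] at h1
      exact h1
    · have h1 := h (i + 1) (by simpa using hi)
      rw [List.take_succ_cons, sup_ofList_cons] at h1
      exact h1

theorem ringKrullDim_add_length_le {Q : Ideal R} {gs : List R} (h : RegularSeqMod Q gs) :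
    ringKrullDim (R ⧸ (Q ⊔ Ideal.ofList gs)) + gs.length ≤ ringKrullDim (R ⧸ Q) := by
  induction gs generalizing Q with
  | nil => rw [Ideal.ofList_nil, sup_bot_eq, List.length_nil, Nat.cast_zero, add_zero]
  | cons g gs ih =>
    rw [sup_ofList_cons, List.length_cons, Nat.cast_add, Nat.cast_one, ← add_assoc]
    refine (add_le_add_left (ih h.2) 1).trans ?_
    have hle : Q ≤ Q ⊔ Ideal.span {g} := le_sup_left
    refine ringKrullDim_succ_le_of_surjective (Ideal.Quotient.factor hle)
      (Ideal.Quotient.factor_surjective hle) (r := Ideal.Quotient.mk Q g) ?_ ?_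
    · rw [mem_nonZeroDivisors_iff_right]
      intro a ha
      obtain ⟨s, rfl⟩ := Ideal.Quotient.mk_surjective a
      rw [← map_mul, Ideal.Quotient.eq_zero_iff_mem] at ha
      exact Ideal.Quotient.eq_zero_iff_mem.mpr (h.1 s (by rwa [mul_comm]))
    · rw [Ideal.Quotient.factor_mk, Ideal.Quotient.eq_zero_iff_mem]
      exact Ideal.mem_sup_right (Ideal.mem_span_singleton_self g)

theorem ringKrullDim_ofList_add_length_le {gs : List R} (h : RegularSeqMod ⊥ gs) :
    ringKrullDim (R ⧸ Ideal.ofList gs) + gs.length ≤ ringKrullDim R := by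
  have h1 := ringKrullDim_add_length_le h
  rw [bot_sup_eq] at h1
  exact h1.trans (ringKrullDim_quotient_le ⊥)

end RegularModIdeal

theorem finite_of_ringKrullDim_le_zero (K : Type*) [Field K] (R : Type*) [CommRing R] [Algebra K R]
    [Algebra.FiniteType K R] (h : ringKrullDim R ≤ 0) : Module.Finite K R := by
  rw [Module.finite_iff_krullDimLE_zero, Ring.KrullDimLE, Order.krullDimLE_iff]
  exact h

/-! ### The irrelevant ideal of a polynomial ring and generic linear forms -/

section LinearForms

open MvPolynomial

variable {K : Type*} [Field K] {σ : Type*}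

variable (K σ) in
/-- The ideal generated by the variables. -/
noncomputable def varIdeal : Ideal (MvPolynomial σ K) := Ideal.span (Set.range X)

/-- No nonzero element of `S / Q` is killed by all the variables. -/
def SocleFree (Q : Ideal (MvPolynomial σ K)) : Prop := ∀ s, (∀ i, X i * s ∈ Q) → s ∈ Q

theorem mul_mem_of_mem_varIdeal {Q : Ideal (MvPolynomial σ K)} {s g : MvPolynomial σ K}
    (h : ∀ i, X i * s ∈ Q) (hg : g ∈ varIdeal K σ) : g * s ∈ Q := by
  have : varIdeal K σ ≤ Q.colon {s} := by
    refine Ideal.span_le.mpr ?_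
    rintro _ ⟨i, rfl⟩
    exact Submodule.mem_colon_singleton.mpr (h i)
  exact Submodule.mem_colon_singleton.mp (this hg)

theorem RegularMod.socleFree {Q : Ideal (MvPolynomial σ K)} {g : MvPolynomial σ K}
    (h : RegularMod Q g) (hg : g ∈ varIdeal K σ) : SocleFree Q :=
  fun s hs => h s (mul_mem_of_mem_varIdeal hs hg)

theorem RegularSeqMod.socleFree {Q : Ideal (MvPolynomial σ K)} {gs : List (MvPolynomial σ K)}
    {g : MvPolynomial σ K} (h : RegularSeqMod Q (gs ++ [g]))
    (hgs : ∀ p ∈ gs ++ [g], p ∈ varIdeal K σ) : ∀ J ∈ partialIdeals Q gs, SocleFree J := by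
  induction gs generalizing Q with
  | nil =>
    intro J hJ
    rw [partialIdeals, List.mem_singleton] at hJ
    subst hJ
    exact RegularMod.socleFree h.1 (hgs g (by simp))
  | cons f gs ih =>
    intro J hJ
    rw [partialIdeals, List.mem_cons] at hJ
    rcases hJ with rfl | hJ
    · exact RegularMod.socleFree h.1 (hgs f (by simp))
    · exact ih h.2 (fun p hp => hgs p (List.mem_cons_of_mem _ hp)) J hJ

/-- The socles of `S/(Q, x)` and `S/(Q, y)` correspond, both being `Ext¹(K, S/Q)`. Explicitly, a
socle element `v` modulo `(Q, y)` gives `x * v ≡ y * u` modulo `Q`, and `u` is a socle element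
modulo `(Q, x)`. -/
theorem SocleFree.exchange {Q : Ideal (MvPolynomial σ K)} {x y : MvPolynomial σ K}
    (hx : RegularMod Q x) (hy : RegularMod Q y) (hxm : x ∈ varIdeal K σ)
    (h : SocleFree (Q ⊔ Ideal.span {x})) : SocleFree (Q ⊔ Ideal.span {y}) := by
  intro v hv
  obtain ⟨q, hq, u, hu⟩ := mem_sup_span_singleton.mp (mul_mem_of_mem_varIdeal hv hxm)
  have h1 : u ∈ Q ⊔ Ideal.span {x} := h u fun i => by
    obtain ⟨q', hq', w, hw⟩ := mem_sup_span_singleton.mp (hv i)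
    have h2 : y * (X i * u - x * w) ∈ Q := by
      have : y * (X i * u - x * w) = x * q' - X i * q := by
        linear_combination (-(X i)) * hu + x * hw
      rw [this]
      exact sub_mem (Q.mul_mem_left _ hq') (Q.mul_mem_left _ hq)
    exact mem_sup_span_singleton.mpr ⟨_, hy _ h2, w, by ring⟩
  obtain ⟨q', hq', z, rfl⟩ := mem_sup_span_singleton.mp h1
  have h2 : x * (v - y * z) ∈ Q := by
    have : x * (v - y * z) = q + y * q' := by linear_combination hu
    rw [this]
    exact add_mem hq (Q.mul_mem_left _ hq')
  exact mem_sup_span_singleton.mpr ⟨_, hx _ h2, z, by ring⟩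

variable [Fintype σ]

/-- The linear form with coefficient vector `v`. -/
noncomputable def linForm : (σ → K) →ₗ[K] MvPolynomial σ K where
  toFun v := ∑ i, v i • X i
  map_add' v w := by simp only [Pi.add_apply, add_smul, Finset.sum_add_distrib]
  map_smul' c v := by simp only [Pi.smul_apply, smul_eq_mul, mul_smul, Finset.smul_sum,
    RingHom.id_apply]

theorem linForm_apply (v : σ → K) : linForm v = ∑ i, v i • (X i : MvPolynomial σ K) := rfl

theorem linForm_single [DecidableEq σ] (i : σ) :
    linForm (Pi.single i 1) = (X i : MvPolynomial σ K) := by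
  rw [linForm_apply, Finset.sum_eq_single i]
  · simp
  · intro j _ hj
    simp [Pi.single_eq_of_ne hj]
  · simp

theorem linForm_isHomogeneous (v : σ → K) : (linForm v).IsHomogeneous 1 := by
  refine IsHomogeneous.sum _ _ _ fun i _ => ?_
  rw [smul_eq_C_mul]
  simpa using (isHomogeneous_C σ (v i)).mul (isHomogeneous_X K i)

theorem linForm_mem_varIdeal (v : σ → K) : linForm v ∈ varIdeal K σ :=
  sum_mem fun i _ => Submodule.smul_of_tower_mem _ _ (Ideal.subset_span ⟨i, rfl⟩)

/-- Prime avoidance by linear algebra: if an associated prime of `S/J` contained all linear forms,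
its annihilated element would be a nonzero socle element. So each associated prime contains only a
proper subspace of linear forms, and finitely many proper subspaces do not cover a vector space over
an infinite field. -/
theorem exists_linForm_regularMod [Infinite K] (L : List (Ideal (MvPolynomial σ K)))
    (hL : ∀ J ∈ L, SocleFree J) (W : Submodule K (σ → K)) (hW : W ≠ ⊤) :
    ∃ v ∉ W, ∀ J ∈ L, RegularMod J (linForm v) := by
  classical
  let sub : Ideal (MvPolynomial σ K) → Submodule K (σ → K) :=
    fun P => (P.restrictScalars K).comap linForm
  have hfin : (⋃ J ∈ {J | J ∈ L},
      associatedPrimes (MvPolynomial σ K) (MvPolynomial σ K ⧸ J)).Finite :=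
    (List.finite_toSet L).biUnion fun J _ => associatedPrimes.finite _ _
  let F : Finset (Submodule K (σ → K)) := insert W (hfin.toFinset.image sub)
  have hF : ⊤ ∉ F := by
    intro hmem
    rcases Finset.mem_insert.mp hmem with h | h
    · exact hW h.symm
    · obtain ⟨P, hP, hPtop⟩ := Finset.mem_image.mp h
      rw [Set.Finite.mem_toFinset, Set.mem_iUnion₂] at hP
      obtain ⟨J, hJ, hP⟩ := hP
      obtain ⟨hprime, a, ha⟩ := isAssociatedPrime_iff.mp hP
      obtain ⟨s, rfl⟩ := Ideal.Quotient.mk_surjective a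
      have hs : s ∈ J := hL J hJ s fun i => by
        have h1 : Pi.single i 1 ∈ sub P := by rw [hPtop]; trivial
        change linForm (Pi.single i 1) ∈ P at h1
        rw [linForm_single, ha, Submodule.mem_colon_singleton, Submodule.mem_bot] at h1
        exact Ideal.Quotient.eq_zero_iff_mem.mp h1
      refine hprime.ne_top ?_
      rw [ha, Ideal.Quotient.eq_zero_iff_mem.mpr hs]
      exact Ideal.eq_top_iff_one _ |>.mpr (Submodule.mem_colon_singleton.mpr (by simp))
  obtain ⟨v, hv⟩ := (Set.ne_univ_iff_exists_notMem _).mp (Subspace.biUnion_ne_univ_of_top_notMem hF)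
  simp only [Set.mem_iUnion, not_exists] at hv
  refine ⟨v, hv W (Finset.mem_insert_self _ _), fun J hJ => ?_⟩
  rw [regularMod_iff_isSMulRegular]
  by_contra hreg
  have hmem : linForm v ∈ ({r | IsSMulRegular (MvPolynomial σ K ⧸ J) r}ᶜ : Set _) := hreg
  rw [← biUnion_associatedPrimes_eq_compl_regular (MvPolynomial σ K), Set.mem_iUnion₂] at hmem
  obtain ⟨P, hP, hvP⟩ := hmem
  refine hv (sub P) (Finset.mem_insert_of_mem (Finset.mem_image_of_mem _ ?_)) hvP
  exact (Set.Finite.mem_toFinset _).mpr (Set.mem_iUnion₂.mpr ⟨J, hJ, hP⟩)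

/-- This is the independence of depth from the regular sequence chosen. The last members of both
sequences are exchanged for one common generic linear form, which is absorbed into `Q`; the shorter
sequences are handled by induction. -/
theorem SocleFree.exchange_list [Infinite K] [Nonempty σ] {fs gs : List (MvPolynomial σ K)}
    {Q : Ideal (MvPolynomial σ K)}
    (hlen : fs.length = gs.length) (hf : RegularSeqMod Q fs) (hg : RegularSeqMod Q gs)
    (hfm : ∀ p ∈ fs, p ∈ varIdeal K σ) (hgm : ∀ p ∈ gs, p ∈ varIdeal K σ)
    (h : SocleFree (Q ⊔ Ideal.ofList fs)) : SocleFree (Q ⊔ Ideal.ofList gs) := by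
  induction fs using List.reverseRecOn generalizing gs Q with
  | nil =>
    obtain rfl : gs = [] := by simpa using hlen.symm
    exact h
  | append_singleton fs f ih =>
    rcases List.eq_nil_or_concat' gs with rfl | ⟨gs, g, rfl⟩
    · simp at hlen
    obtain ⟨v, -, hv⟩ := exists_linForm_regularMod (partialIdeals Q fs ++ partialIdeals Q gs)
      (fun J hJ => (List.mem_append.mp hJ).elim (hf.socleFree hfm J) (hg.socleFree hgm J)) ⊥
      bot_ne_top
    have hvf := fun J hJ => hv J (List.mem_append_left _ hJ)
    have hvg := fun J hJ => hv J (List.mem_append_right _ hJ)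
    have hf' := regularSeqMod_append_singleton.mp hf
    have hg' := regularSeqMod_append_singleton.mp hg
    rw [sup_ofList_append, Ideal.ofList_singleton] at h ⊢
    have h1 := SocleFree.exchange hf'.2 (hvf _ (last_mem_partialIdeals _ _))
      (hfm f (by simp)) h
    rw [sup_right_comm] at h1
    have h2 := ih (Q := Q ⊔ Ideal.span {linForm v}) (gs := gs) (by simpa using hlen)
      (hf'.1.sup hvf) (hg'.1.sup hvg)
      (fun p hp => hfm p (List.mem_append_left _ hp))
      (fun p hp => hgm p (List.mem_append_left _ hp)) h1
    rw [sup_right_comm] at h2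
    exact SocleFree.exchange (hvg _ (last_mem_partialIdeals _ _)) hg'.2
      (linForm_mem_varIdeal v) h2

end LinearForms

/-! ### Regular sequences of variables and positive depth of `S/(f)`. -/

section Variables

open MvPolynomial

variable {K : Type*} [Field K] {σ : Type*}

theorem regularMod_span_X {s : Set σ} {j : σ} (hj : j ∉ s) :
    RegularMod (Ideal.span (X '' s : Set (MvPolynomial σ K))) (X j) := by
  classical
  intro p hp
  rw [mem_ideal_span_X_image] at hp ⊢
  intro m hm
  obtain ⟨i, hi, h⟩ := hp (m + Finsupp.single j 1) (by
    rw [mem_support_iff, mul_comm, coeff_mul_X]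
    exact mem_support_iff.mp hm)
  have hij : j ≠ i := by rintro rfl; exact hj hi
  refine ⟨i, hi, ?_⟩
  rwa [Finsupp.add_apply, Finsupp.single_eq_of_ne' hij, add_zero] at h

theorem regularSeqMod_X {l : List σ} (hl : l.Nodup) {s : Set σ} (hs : ∀ i ∈ l, i ∉ s) :
    RegularSeqMod (Ideal.span (X '' s : Set (MvPolynomial σ K))) (l.map X) := by
  induction l generalizing s with
  | nil => trivial
  | cons j l ih =>
    refine ⟨regularMod_span_X (hs j (by simp)), ?_⟩
    rw [← Ideal.span_union, ← Set.image_singleton, ← Set.image_union]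
    refine ih hl.of_cons fun i hi h => ?_
    rcases h with h | h
    · exact hs i (List.mem_cons_of_mem _ hi) h
    · rw [Set.mem_singleton_iff] at h
      subst h
      exact (List.nodup_cons.mp hl).1 hi

/-- The comparison sequence consists of the first `n` variables: modulo these, the last variable is
still regular, so there is no socle. -/
theorem socleFree_of_regularSeqMod [Infinite K] {n : ℕ} {fs : List (MvPolynomial (Fin (n + 1)) K)}
    (hlen : fs.length = n) (hf : RegularSeqMod ⊥ fs)
    (hfm : ∀ p ∈ fs, p ∈ varIdeal K (Fin (n + 1))) : SocleFree (Ideal.ofList fs) := by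
  have hX : RegularSeqMod (⊥ : Ideal (MvPolynomial (Fin (n + 1)) K))
      (((List.finRange n).map Fin.castSucc).map X) := by
    have := regularSeqMod_X (K := K) (l := (List.finRange n).map Fin.castSucc) (s := ∅)
      ((List.nodup_finRange n).map (Fin.castSucc_injective n)) (by simp)
    simpa using this
  have h := SocleFree.exchange_list (Q := ⊥) (gs := fs) (by simp [hlen]) hX hf
    (by
      intro p hp
      obtain ⟨i, -, rfl⟩ := List.mem_map.mp hp
      exact Ideal.subset_span ⟨i, rfl⟩) hfm ?_
  · simpa using h
  · rw [bot_sup_eq]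
    have : Ideal.ofList (((List.finRange n).map Fin.castSucc).map X) =
        Ideal.span (X '' Set.range (Fin.castSucc : Fin n → Fin (n + 1)) :
          Set (MvPolynomial (Fin (n + 1)) K)) := by
      rw [Ideal.ofList]
      congr 1
      ext p
      simp only [List.map_map, List.mem_map, List.mem_finRange, true_and, Function.comp_apply,
        Set.mem_image, Set.mem_range, exists_exists_eq_and, Set.mem_ofPred_eq]
    rw [this]
    exact (regularMod_span_X (j := Fin.last n) (by
      rintro ⟨i, hi⟩
      exact (Fin.castSucc_lt_last i).ne hi)).socleFree (Ideal.subset_span ⟨_, rfl⟩)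

end Variables

end GradedDuality

namespace GradedDuality

open MvPolynomial

/-! ### Homogeneous ideals of the polynomial ring. -/

section Homogeneous

variable {K : Type*} [Field K] {σ : Type*}

theorem homogeneousComponent_mul_of_isHomogeneous {g : MvPolynomial σ K} {d : ℕ}
    (hg : g.IsHomogeneous d) (a : MvPolynomial σ K) {N : ℕ} (hN : d ≤ N) :
    homogeneousComponent N (a * g) = homogeneousComponent (N - d) a * g := by
  conv_lhs => rw [← sum_homogeneousComponent a, Finset.sum_mul, map_sum]
  have h1 : ∀ i, homogeneousComponent N (homogeneousComponent i a * g) =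
      if i = N - d then homogeneousComponent i a * g else 0 := by
    intro i
    rw [homogeneousComponent_of_mem ((homogeneousComponent_isHomogeneous i a).mul hg)]
    exact if_congr (by omega) rfl rfl
  simp only [h1]
  rw [Finset.sum_ite_eq']
  split_ifs with h
  · rfl
  · rw [homogeneousComponent_eq_zero, zero_mul]
    simp only [Finset.mem_range] at h
    omega

theorem homogeneousComponent_mem_ofList {L : List (MvPolynomial σ K)}
    (hL : ∀ p ∈ L, ∃ d, p.IsHomogeneous d) {s : MvPolynomial σ K} (hs : s ∈ Ideal.ofList L)
    (N : ℕ) : homogeneousComponent N s ∈ Ideal.ofList L :=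
  letI := MvPolynomial.gradedAlgebra (σ := σ) (R := K)
  homogeneousComponent_mem_of_mem (Ideal.homogeneous_span _ _ hL) hs N

/-- A monic equation for `h` modulo `I` has the pure power of `h` as its component of highest
degree, and `I` is homogeneous. -/
theorem pow_mem_of_finite {I : Ideal (MvPolynomial σ K)}
    (hI : ∀ s ∈ I, ∀ N, homogeneousComponent N s ∈ I)
    [Module.Finite K (MvPolynomial σ K ⧸ I)] {h : MvPolynomial σ K} (hh : h.IsHomogeneous 1) :
    ∃ N, h ^ N ∈ I := by
  obtain ⟨p, hp, hp0⟩ := Algebra.IsIntegral.isIntegral (R := K) (Ideal.Quotient.mk I h)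
  refine ⟨p.natDegree, ?_⟩
  have h1 : Polynomial.aeval h p ∈ I := by
    rw [← Ideal.Quotient.eq_zero_iff_mem, ← hp0, ← Polynomial.aeval_def]
    exact (Polynomial.aeval_algHom_apply (Ideal.Quotient.mkₐ K I) h p).symm
  have h2 := hI _ h1 p.natDegree
  rw [Polynomial.aeval_eq_sum_range, map_sum, Finset.sum_range_succ, Finset.sum_eq_zero, zero_add,
    map_smul, homogeneousComponent_eq_self (by simpa using hh.pow p.natDegree),
    hp.coeff_natDegree, one_smul] at h2
  · exact h2
  · intro i hi
    rw [Finset.mem_range] at hi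
    rw [map_smul, homogeneousComponent_of_mem (n := i) (by simpa using hh.pow i), if_neg hi.ne',
      smul_zero]

end Homogeneous

/-! ### Graded Gorenstein ideals -/

section Gorenstein

variable {K : Type*} [Field K] {σ : Type*}

/-- `S / I` carries a linear form, concentrated in degree `m`, whose associated bilinear form
`(s, t) ↦ θ (s * t)` is nondegenerate. -/
def HasSocleForm (I : Ideal (MvPolynomial σ K)) (m : ℤ) : Prop :=
  ∃ θ : MvPolynomial σ K →ₗ[K] K, (∀ s ∈ I, θ s = 0) ∧
    (∀ (j : ℕ) (s : MvPolynomial σ K), s.IsHomogeneous j → (j : ℤ) ≠ m → θ s = 0) ∧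
    ∀ s, (∀ t, θ (s * t) = 0) → s ∈ I

/-- If `I` is the colon ideal `J : c`, multiplication by `c` embeds `S/I` in `S/J`, and `θ (c * s)`
is the required form. -/
theorem HasSocleForm.of_mul {I J : Ideal (MvPolynomial σ K)} {m : ℤ} (h : HasSocleForm J m)
    {c : MvPolynomial σ K} {d : ℕ} (hc : c.IsHomogeneous d) (hcIJ : ∀ s, s ∈ I ↔ c * s ∈ J) :
    HasSocleForm I (m - d) := by
  obtain ⟨θ, h1, h2, h3⟩ := h
  refine ⟨θ ∘ₗ LinearMap.mulLeft K c, fun s hs => h1 _ ((hcIJ s).mp hs), fun j s hs hj => ?_,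
    fun s hs => (hcIJ s).mpr (h3 _ fun t => ?_)⟩
  · refine h2 (d + j) _ (hc.mul hs) ?_
    push_cast
    omega
  · rw [mul_assoc]
    exact hs t

/-- The form is the coefficient of the socle monomial `∏ X i ^ (N i - 1)`. A monomial `m` occurring
in `s` and lying outside the ideal divides it, and multiplying `s` by the complementary monomial
moves the coefficient of `m` there. -/
theorem hasSocleForm_span_X_pow [Fintype σ] (N : σ → ℕ) (hN : ∀ i, 1 ≤ N i) :
    HasSocleForm (Ideal.span (Set.range fun i => (X i : MvPolynomial σ K) ^ N i))
      (∑ i, ((N i : ℤ) - 1)) := by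
  classical
  let top : σ →₀ ℕ := Finsupp.equivFunOnFinite.symm fun i => N i - 1
  have htop : ∀ i, top i = N i - 1 := fun i => rfl
  have hspan : Ideal.span (Set.range fun i => (X i : MvPolynomial σ K) ^ N i) =
      Ideal.span ((fun s => monomial s (1 : K)) ''
        Set.range fun i => Finsupp.single i (N i)) := by
    rw [← Set.range_comp]
    congr 2
    ext1 i
    exact X_pow_eq_monomial
  have hmem : ∀ s : MvPolynomial σ K,
      s ∈ Ideal.span (Set.range fun i => (X i : MvPolynomial σ K) ^ N i) ↔
        ∀ m ∈ s.support, ∃ i, N i ≤ m i := by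
    intro s
    rw [hspan, mem_ideal_span_monomial_image]
    refine forall₂_congr fun m _ => ?_
    simp [Finsupp.single_le_iff]
  refine ⟨lcoeff K top, fun s hs => ?_, fun j s hs hj => ?_, fun s hs => ?_⟩
  · by_contra h
    obtain ⟨i, hi⟩ := (hmem s).mp hs top (mem_support_iff.mpr h)
    have := hN i
    rw [htop] at hi
    omega
  · by_contra h
    have h1 : top.degree = j := by
      by_contra hne
      exact h (hs.coeff_eq_zero hne)
    refine hj ?_
    rw [← h1, Finsupp.degree_eq_sum, Nat.cast_sum]
    refine Finset.sum_congr rfl fun i _ => ?_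
    rw [htop, Nat.cast_sub (hN i), Nat.cast_one]
  · rw [hmem]
    intro m hm
    by_contra! hlt
    have hle : m ≤ top := fun i => by
      rw [htop]
      have := hlt i
      omega
    have := hs (monomial (top - m) 1)
    rw [lcoeff_apply, coeff_mul_monomial', if_pos tsub_le_self, tsub_tsub_cancel_of_le hle,
      mul_one] at this
    exact mem_support_iff.mp hm this

/-- The substitution of linear forms for the variables. -/
noncomputable def linSubst [Fintype σ] (A : Matrix σ σ K) : MvPolynomial σ K →ₐ[K] MvPolynomial σ K :=
  aeval fun i => linForm (A i)

theorem linSubst_linForm [Fintype σ] (A : Matrix σ σ K) (v : σ → K) :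
    linSubst A (linForm v) = linForm (Matrix.vecMul v A) := by
  rw [linForm_apply, map_sum]
  simp only [map_smul, linSubst, aeval_X]
  rw [Matrix.vecMul_eq_sum, map_sum]
  simp only [map_smul]

theorem linSubst_linSubst [Fintype σ] [DecidableEq σ] {A B : Matrix σ σ K} (h : B * A = 1)
    (s : MvPolynomial σ K) : linSubst A (linSubst B s) = s := by
  have : (linSubst A).comp (linSubst B) = AlgHom.id K _ := by
    ext1 i
    rw [AlgHom.comp_apply, AlgHom.id_apply, linSubst, linSubst, aeval_X, ← linSubst,
      linSubst_linForm, ← Matrix.mul_apply_eq_vecMul, h, ← linForm_single]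
    congr 1
    ext j
    rw [Matrix.one_apply, Pi.single_apply]
    exact if_congr eq_comm rfl rfl
  exact AlgHom.congr_fun this s

theorem HasSocleForm.linSubst [Fintype σ] [DecidableEq σ] {I J : Ideal (MvPolynomial σ K)} {m : ℤ}
    (h : HasSocleForm I m) {A B : Matrix σ σ K} (hAB : A * B = 1)
    (hJ : ∀ s, s ∈ J ↔ GradedDuality.linSubst B s ∈ I) : HasSocleForm J m := by
  obtain ⟨θ, h1, h2, h3⟩ := h
  refine ⟨θ ∘ₗ (GradedDuality.linSubst B).toLinearMap, fun s hs => h1 _ ((hJ s).mp hs),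
    fun j s hs hj => h2 j _ ?_ hj, fun s hs => (hJ s).mpr (h3 _ fun t => ?_)⟩
  · have := hs.aeval (fun i => linForm (B i)) fun i => linForm_isHomogeneous (B i)
    rwa [one_mul] at this
  · have := hs (GradedDuality.linSubst A t)
    rwa [LinearMap.comp_apply, AlgHom.toLinearMap_apply, map_mul, linSubst_linSubst hAB] at this

theorem map_mem_span_range {R S ι : Type*} [CommRing R] [CommRing S] (φ : R →+* S) {a : ι → R}
    {b : ι → S} (h : ∀ i, φ (a i) = b i) {s : R} (hs : s ∈ Ideal.span (Set.range a)) :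
    φ s ∈ Ideal.span (Set.range b) := by
  have := Ideal.mem_map_of_mem φ hs
  rwa [Ideal.map_span, ← Set.range_comp, funext (show ∀ i, (φ ∘ a) i = b i from h)] at this

theorem hasSocleForm_span_linForm_pow [Fintype σ] {v : σ → σ → K} (hv : LinearIndependent K v)
    (N : σ → ℕ) (hN : ∀ i, 1 ≤ N i) :
    HasSocleForm (Ideal.span (Set.range fun i => (linForm (v i) : MvPolynomial σ K) ^ N i))
      (∑ i, ((N i : ℤ) - 1)) := by
  classical
  let A : Matrix σ σ K := Matrix.of v
  have hA : IsUnit A := Matrix.linearIndependent_rows_iff_isUnit.mp hv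
  obtain ⟨B, hAB, hBA⟩ := isUnit_iff_exists.mp hA
  have hAX : ∀ i, linSubst A (X i) = linForm (v i) := fun i => by rw [linSubst, aeval_X]; rfl
  have hBv : ∀ i, linSubst B (linForm (v i)) = X i := fun i => by
    rw [← hAX, linSubst_linSubst hAB]
  refine (hasSocleForm_span_X_pow N hN).linSubst hAB fun s => ⟨fun hs => ?_, fun hs => ?_⟩
  · exact map_mem_span_range (linSubst B).toRingHom
      (fun i => (map_pow (linSubst B) _ _).trans (by rw [hBv])) hs
  · have h2 := map_mem_span_range (linSubst A).toRingHom
      (fun i => (map_pow (linSubst A) _ _).trans (by rw [hAX])) hs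
    rw [← linSubst_linSubst hBA s]
    exact h2

/-- Writing `g = r + f * c` with `r` in `(L)` gives `(L, g) : c = (L, f)`, because `g` is regular
modulo `(L)`. So the form for `(L, g)` is transported by multiplication by `c`, of degree `N - d`.
-/
theorem HasSocleForm.replace {L : List (MvPolynomial σ K)} (hL : ∀ p ∈ L, ∃ d, p.IsHomogeneous d)
    {f g : MvPolynomial σ K} {d N : ℕ} (hf : f.IsHomogeneous d) (hg : g.IsHomogeneous N)
    (hdN : d ≤ N) (hreg : RegularMod (Ideal.ofList L) g)
    (hgf : g ∈ Ideal.ofList L ⊔ Ideal.span {f}) {m : ℤ}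
    (h : HasSocleForm (Ideal.ofList L ⊔ Ideal.span {g}) m) :
    HasSocleForm (Ideal.ofList L ⊔ Ideal.span {f}) (m - (N - d : ℕ)) := by
  obtain ⟨q, hq, a, ha⟩ := mem_sup_span_singleton.mp hgf
  have hq' := homogeneousComponent_mem_ofList hL hq N
  -- Passing to components of degree `N` makes the multiplier `c` homogeneous.
  have hg' : g = homogeneousComponent N q + f * homogeneousComponent (N - d) a := by
    conv_lhs => rw [← homogeneousComponent_eq_self hg, ha, map_add, mul_comm,
      homogeneousComponent_mul_of_isHomogeneous hf a hdN, mul_comm]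
  generalize homogeneousComponent N q = r at hq' hg'
  refine h.of_mul (homogeneousComponent_isHomogeneous (N - d) a) fun s => ?_
  generalize homogeneousComponent (N - d) a = c at hg' ⊢
  constructor
  · intro hs
    obtain ⟨q, hq, u, rfl⟩ := mem_sup_span_singleton.mp hs
    refine mem_sup_span_singleton.mpr ⟨c * q - r * u,
      sub_mem (Ideal.mul_mem_left _ _ hq) (Ideal.mul_mem_right _ _ hq'), u, ?_⟩
    rw [hg']
    ring
  · intro hs
    obtain ⟨q, hq, u, hu⟩ := mem_sup_span_singleton.mp hs
    have h1 : g * (s - f * u) ∈ Ideal.ofList L := by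
      have : g * (s - f * u) = f * q + r * (s - f * u) + f * (r * u) := by
        linear_combination (s - f * u) * hg' + f * hu + f * u * hg'
      rw [this]
      exact add_mem (add_mem (Ideal.mul_mem_left _ _ hq) (Ideal.mul_mem_right _ _ hq'))
        (Ideal.mul_mem_left _ _ (Ideal.mul_mem_right _ _ hq'))
    exact mem_sup_span_singleton.mpr ⟨_, hreg _ h1, u, by ring⟩

theorem finite_quotient_of_regularSeqMod {n : ℕ} {L : List (MvPolynomial (Fin (n + 1)) K)}
    (hL : RegularSeqMod ⊥ L) (hlen : n + 1 ≤ L.length) :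
    Module.Finite K (MvPolynomial (Fin (n + 1)) K ⧸ Ideal.ofList L) := by
  have h := ringKrullDim_ofList_add_length_le hL
  rw [ringKrullDim_of_isNoetherianRing, ringKrullDim_eq_zero_of_field, zero_add,
    Nat.card_eq_fintype_card, Fintype.card_fin] at h
  refine finite_of_ringKrullDim_le_zero K _ ?_
  generalize ringKrullDim (MvPolynomial (Fin (n + 1)) K ⧸ Ideal.ofList L) = D at h ⊢
  induction D using WithBot.recBotCoe with
  | bot => exact bot_le
  | coe D =>
    have h1 : D + L.length ≤ (n + 1 : ℕ) := by exact_mod_cast h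
    lift D to ℕ using fun hD => by simp [hD] at h1
    have h2 : D + L.length ≤ n + 1 := by exact_mod_cast h1
    have h3 : D = 0 := by omega
    rw [h3]
    rfl

/-- Induction on the number of polynomials that are not powers of linear forms. The last one, `p`,
is traded for a high power of a new generic linear form; when none is left, the ideal is generated
by powers of `n + 1` independent linear forms. The exponent of the auxiliary power cancels from the
socle degree. -/
theorem hasSocleForm_of_regularSeqMod [Infinite K] {n : ℕ}
    (fs : List (MvPolynomial (Fin (n + 1)) K × ℕ)) {k : ℕ} (hk : k + fs.length = n + 1)
    {v : Fin k → Fin (n + 1) → K} (hv : LinearIndependent K v) {N : Fin k → ℕ}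
    (hN : ∀ i, 1 ≤ N i) (hfs : ∀ p ∈ fs, p.1.IsHomogeneous p.2 ∧ p.1 ∈ varIdeal K (Fin (n + 1)))
    (hreg : RegularSeqMod ⊥ (List.ofFn (fun i => linForm (v i) ^ N i) ++ fs.map Prod.fst)) :
    HasSocleForm (Ideal.ofList (List.ofFn (fun i => linForm (v i) ^ N i) ++ fs.map Prod.fst))
      (∑ i, ((N i : ℤ) - 1) + (fs.map fun p => (p.2 : ℤ) - 1).sum) := by
  induction fs using List.reverseRecOn generalizing k with
  | nil =>
    obtain rfl : k = n + 1 := by simpa using hk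
    have := hasSocleForm_span_linForm_pow hv N hN
    rw [List.map_nil, List.map_nil, List.sum_nil, add_zero, List.append_nil, Ideal.ofList]
    convert! this using 3
    ext p
    exact List.mem_ofFn
  | append_singleton fs p ih =>
    rw [List.length_append, List.length_singleton] at hk
    obtain ⟨hp, hpm⟩ := hfs p (by simp)
    have hfs' : ∀ q ∈ fs, q.1.IsHomogeneous q.2 ∧ q.1 ∈ varIdeal K (Fin (n + 1)) :=
      fun q hq => hfs q (List.mem_append_left _ hq)
    rw [List.map_append, List.map_singleton, ← List.append_assoc] at hreg ⊢
    set L := List.ofFn (fun i => linForm (v i) ^ N i) ++ fs.map Prod.fst with hLdef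
    have hLhom : ∀ q ∈ L, ∃ d, q.IsHomogeneous d := by
      intro q hq
      rcases List.mem_append.mp hq with h | h
      · obtain ⟨i, rfl⟩ := List.mem_ofFn.mp h
        exact ⟨_, (linForm_isHomogeneous (v i)).pow _⟩
      · obtain ⟨q, hq', rfl⟩ := List.mem_map.mp h
        exact ⟨_, (hfs' q hq').1⟩
    have hLm : ∀ q ∈ L, q ∈ varIdeal K (Fin (n + 1)) := by
      intro q hq
      rcases List.mem_append.mp hq with h | h
      · obtain ⟨i, rfl⟩ := List.mem_ofFn.mp h
        exact Ideal.pow_mem_of_mem _ (linForm_mem_varIdeal _) _ (hN i)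
      · obtain ⟨q, hq', rfl⟩ := List.mem_map.mp h
        exact (hfs' q hq').2
    have hlen : n + 1 ≤ (L ++ [p.1]).length := by
      simp only [hLdef, List.length_append, List.length_ofFn, List.length_map,
        List.length_singleton]
      omega
    have hfin := finite_quotient_of_regularSeqMod hreg hlen
    have hreg' := regularSeqMod_append_singleton.mp hreg
    have hW : Submodule.span K (Set.range v) ≠ ⊤ := by
      intro h
      have h1 := finrank_span_eq_card hv
      rw [h, finrank_top, Module.finrank_fin_fun, Fintype.card_fin] at h1
      omega
    obtain ⟨w, hw, hwL⟩ := exists_linForm_regularMod (partialIdeals ⊥ L)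
      (hreg.socleFree (by
        intro q hq
        rcases List.mem_append.mp hq with h | h
        · exact hLm q h
        · rw [List.mem_singleton.mp h]; exact hpm)) _ hW
    obtain ⟨N₀, hN₀⟩ := pow_mem_of_finite (I := Ideal.ofList (L ++ [p.1]))
      (fun s hs => homogeneousComponent_mem_ofList (by
        intro q hq
        rcases List.mem_append.mp hq with h | h
        · exact hLhom q h
        · rw [List.mem_singleton.mp h]; exact ⟨_, hp⟩) hs) (linForm_isHomogeneous w)
    -- Large enough for the power to lie in the ideal, for its degree to be at least that of `p`,
    -- and for the exponent to be positive.
    let N₁ := N₀ + p.2 + 1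
    have hN₁ : linForm w ^ N₁ ∈ Ideal.ofList L ⊔ Ideal.span {p.1} := by
      rw [← Ideal.ofList_singleton, ← Ideal.ofList_append]
      exact Ideal.pow_mem_of_pow_mem _ hN₀ (by omega)
    have hih := ih (k := k + 1) (by omega) (v := Fin.cons w v)
      (linearIndependent_finCons.mpr ⟨hv, hw⟩) (N := Fin.cons N₁ N)
      (fun i => by
        refine Fin.cases ?_ (fun i => ?_) i
        · simp [N₁]
        · simpa using hN i) hfs' (by
        rw [List.ofFn_succ]
        simp only [Fin.cons_zero, Fin.cons_succ]
        rw [List.cons_append, ← hLdef]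
        -- The new power is placed at the front of the sequence, where the remaining members stay
        -- regular because `w` is regular modulo all partial ideals.
        refine ⟨(hwL _ (head_mem_partialIdeals _ _)).pow _, ?_⟩
        exact hreg'.1.sup fun J hJ => (hwL J hJ).pow _)
    rw [List.ofFn_succ, Fin.sum_univ_succ] at hih
    simp only [Fin.cons_zero, Fin.cons_succ] at hih
    rw [List.cons_append, ← hLdef, Ideal.ofList_cons, sup_comm] at hih
    have hres := hih.replace hLhom hp
      (by simpa using (linForm_isHomogeneous w).pow N₁) (by omega) (by
        have := (hwL _ (last_mem_partialIdeals _ _)).pow N₁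
        rwa [bot_sup_eq] at this) hN₁
    rw [Ideal.ofList_append, Ideal.ofList_singleton]
    convert! hres using 1
    rw [List.map_append, List.sum_append, List.map_singleton, List.sum_singleton,
      Nat.cast_sub (by omega)]
    ring

end Gorenstein

end GradedDuality

namespace GradedDuality

open Polynomial

/-! ### Regular sequences and dimension -/

theorem length_le_supportDim_of_isRegular {R : Type*} [CommRing R] [IsNoetherianRing R]
    {M : Type*} [AddCommGroup M] [Module R M] [Module.Finite R M] {rs : List R}
    (h : RingTheory.Sequence.IsRegular M rs) : (rs.length : WithBot ℕ∞) ≤ Module.supportDim R M := by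
  induction rs generalizing M with
  | nil =>
    have := h.nontrivial
    rw [List.length_nil, Nat.cast_zero, Module.supportDim]
    have : Nonempty (Module.support R M) := Module.nonempty_support_of_nontrivial.to_subtype
    exact Order.krullDim_nonneg
  | cons r rs ih =>
    obtain ⟨hr, hrs⟩ := (RingTheory.Sequence.isRegular_cons_iff M r rs).mp h
    rw [List.length_cons, Nat.cast_add, Nat.cast_one]
    exact (add_le_add_left (ih hrs) 1).trans
      (Module.supportDim_quotSMulTop_succ_le_of_notMem_minimalPrimes
        fun _ => hr.notMem_of_mem_minimalPrimes)

/-- `R` is a finitely generated nonnegatively graded `K`-algebra of dimension one. -/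
structure IsGradedCurve (K : Type*) [Field K] {R : Type*} [CommRing R] [Algebra K R]
    (𝒜 : ℤ → AddSubgroup R) : Prop where
  graded : IsGradedModule 𝒜 𝒜
  algebraMap_mem : ∀ c : K, algebraMap K R c ∈ 𝒜 0
  eq_zero_of_neg : ∀ k < 0, ∀ r ∈ 𝒜 k, r = 0
  finiteType : Algebra.FiniteType K R
  ringKrullDim_eq : ringKrullDim R = 1

namespace IsGradedCurve

variable {K : Type*} [Field K] {R : Type*} [CommRing R] [Algebra K R] {𝒜 : ℤ → AddSubgroup R}
  (h : IsGradedCurve K 𝒜)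

include h

theorem isNoetherianRing : IsNoetherianRing R :=
  have := h.finiteType
  Algebra.FiniteType.isNoetherianRing K R

theorem one_mem : (1 : R) ∈ 𝒜 0 := by simpa using h.algebraMap_mem 1

theorem finite_quotient {x : R} (hx : IsSMulRegular R x) :
    Module.Finite K (R ⧸ Ideal.span {x}) := by
  have := h.finiteType
  refine finite_of_ringKrullDim_le_zero K _ ?_
  have h1 := ringKrullDim_quotient_succ_le_of_nonZeroDivisor (r := x) (by
    rw [mem_nonZeroDivisors_iff_right]
    intro a ha
    exact hx (by simpa [mul_comm] using ha))
  rw [h.ringKrullDim_eq] at h1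
  generalize ringKrullDim (R ⧸ Ideal.span {x}) = D at h1 ⊢
  induction D using WithBot.recBotCoe with
  | bot => exact bot_le
  | coe D =>
    have h1 : D + 1 ≤ (1 : ℕ) := by exact_mod_cast h1
    lift D to ℕ using fun hD => by simp [hD] at h1
    have h2 : D + 1 ≤ 1 := by exact_mod_cast h1
    have h3 : D = 0 := by omega
    rw [h3]
    rfl

/-- `R/xR` is finite-dimensional, so a homogeneous `y` of positive degree satisfies a monic equation
modulo `x`; its top component is a power of `y`. The radical being an ideal, such elements suffice.
-/
theorem exists_pow_mem {x : R} {e : ℤ} (hx : x ∈ 𝒜 e) (hreg : IsSMulRegular R x) {y : R}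
    (hy : y ∈ irrelevantIdeal 𝒜) : ∃ N, y ^ N ∈ Ideal.span {x} := by
  have := h.finite_quotient hreg
  suffices irrelevantIdeal 𝒜 ≤ (Ideal.span {x}).radical from this hy
  refine Ideal.span_le.mpr ?_
  rintro y ⟨k, hk, hy⟩
  obtain ⟨p, hp, hp0⟩ := Algebra.IsIntegral.isIntegral (R := K)
    (Ideal.Quotient.mk (Ideal.span {x}) y)
  refine ⟨p.natDegree, ?_⟩
  have h1 : aeval y p ∈ Ideal.span {x} := by
    rw [← Ideal.Quotient.eq_zero_iff_mem, ← hp0, ← aeval_def]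
    exact (aeval_algHom_apply (Ideal.Quotient.mkₐ K (Ideal.span {x})) y p).symm
  obtain ⟨z, hz⟩ := Ideal.mem_span_singleton'.mp h1
  have hmem : ∀ i : ℕ, p.coeff i • y ^ i ∈ 𝒜 (i * k) := fun i => by
    rw [Algebra.smul_def, ← zero_add ((i : ℤ) * k)]
    exact h.graded.smul_mem _ _ _ _ (h.algebraMap_mem _)
      (pow_mem_grading h.graded h.one_mem hy i)
  have h2 : component h.graded.isInternal (p.natDegree * k) (aeval y p) = y ^ p.natDegree := by
    rw [aeval_eq_sum_range, map_sum, Finset.sum_range_succ, Finset.sum_eq_zero, zero_add,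
      component_of_mem _ (hmem _), hp.coeff_natDegree, one_smul]
    intro i hi
    refine component_of_mem_ne _ ?_ (hmem i)
    rw [Finset.mem_range] at hi
    intro heq
    have := mul_right_cancel₀ hk.ne' heq
    omega
  rw [← h2, ← hz, mul_comm z x, ← smul_eq_mul x z,
    show (p.natDegree * k : ℤ) = e + (p.natDegree * k - e) by ring, h.graded.component_smul hx]
  exact Ideal.mem_span_singleton'.mpr ⟨_, mul_comm _ _⟩

/-- Graded Nakayama: the homogeneous components of lifts of generators of `R/xR` generate `R` over
`K[X]`. -/
theorem finite_polynomial [Algebra K[X] R] [IsScalarTower K K[X] R] {x : R} {e : ℤ} (he : 0 < e)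
    (hxX : algebraMap K[X] R X = x) (hx : x ∈ 𝒜 e) (hreg : IsSMulRegular R x) :
    Module.Finite K[X] R := by
  classical
  have := h.finite_quotient hreg
  obtain ⟨G, hG⟩ := (Module.Finite.fg_top : (⊤ : Submodule K (R ⧸ Ideal.span {x})).FG)
  choose lift hlift using fun a : R ⧸ Ideal.span {x} => Ideal.Quotient.mk_surjective a
  choose F hF0 hF using fun r : R => exists_sum_component h.graded.isInternal r
  let B : Finset R := G.biUnion fun g =>
    (F (lift g)).image fun k => component h.graded.isInternal k (lift g)
  have hcomp : ∀ g ∈ G, ∀ k, component h.graded.isInternal k (lift g) ∈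
      Submodule.span K[X] (B : Set R) := by
    intro g hg k
    by_cases hk : k ∈ F (lift g)
    · exact Submodule.subset_span
        (Finset.mem_biUnion.mpr ⟨g, hg, Finset.mem_image_of_mem _ hk⟩)
    · rw [hF0 _ k hk]
      exact zero_mem _
  have hdecomp : ∀ r : R, ∃ c : (R ⧸ Ideal.span {x}) → K, ∃ s,
      r = ∑ g ∈ G, c g • lift g + x * s := by
    intro r
    have hr : Ideal.Quotient.mk (Ideal.span {x}) r ∈ Submodule.span K (G : Set _) := by
      rw [hG]; trivial
    obtain ⟨c, hc⟩ := Submodule.mem_span_finset'.mp hr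
    refine ⟨fun g => if hg : g ∈ G then c ⟨g, hg⟩ else 0, ?_⟩
    have : r - ∑ g ∈ G, (if hg : g ∈ G then c ⟨g, hg⟩ else 0) • lift g ∈ Ideal.span {x} := by
      rw [← Ideal.Quotient.eq_zero_iff_mem, map_sub, sub_eq_zero, ← hc, map_sum,
        ← Finset.sum_attach G]
      refine Finset.sum_congr rfl fun g _ => ?_
      rw [dif_pos g.2]
      conv_lhs => rw [← hlift g.1]
      rfl
    obtain ⟨s, hs⟩ := Ideal.mem_span_singleton'.mp this
    exact ⟨s, by rw [mul_comm x s, hs]; ring⟩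
  -- Modulo these generators an element of degree `k` is `x` times one of degree `k - e`. The
  -- descent ends since `e > 0` and negative degrees vanish.
  have key : ∀ (m : ℕ) (k : ℤ), k < m → ∀ r ∈ 𝒜 k, r ∈ Submodule.span K[X] (B : Set R) := by
    intro m
    induction m with
    | zero =>
      intro k hk r hr
      rw [h.eq_zero_of_neg k (by simpa using hk) r hr]
      exact zero_mem _
    | succ m ih =>
      intro k hk r hr
      obtain ⟨c, s, hrs⟩ := hdecomp r
      rw [← component_of_mem h.graded.isInternal hr, hrs, map_add, map_sum]
      refine add_mem (sum_mem fun g hg => ?_) ?_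
      · rw [Algebra.smul_def, ← smul_eq_mul]
        have := h.graded.component_smul (k := k) (h.algebraMap_mem (c g)) (lift g)
        rw [zero_add] at this
        rw [this, IsScalarTower.algebraMap_apply K K[X] R, algebraMap_smul]
        exact Submodule.smul_mem _ _ (hcomp g hg k)
      · have := h.graded.component_smul (k := k - e) hx s
        rw [show e + (k - e) = k by ring, smul_eq_mul] at this
        rw [this, ← hxX, algebraMap_smul]
        exact Submodule.smul_mem _ _ (ih (k - e) (by push_cast at hk; omega) _ (component_mem _ _ _))
  refine ⟨B, ?_⟩
  rw [eq_top_iff]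
  rintro r -
  induction r using homogeneous_induction h.graded.isInternal with
  | zero => exact zero_mem _
  | add r s hr hs => exact add_mem hr hs
  | homogeneous k r hr => exact key (k.toNat + 1) k (by push_cast; omega) r hr

/-- Depth one provides some element `r` of the irrelevant ideal that is regular on `M`. A power of
`r` is a multiple of `x`, so `x` is regular too. -/
theorem isSMulRegular_of_isMCM {M : Type*} [AddCommGroup M] [Module R M] {ℳ : ℤ → AddSubgroup M}
    (hM : IsMCM 𝒜 ℳ) {x : R} {e : ℤ} (hx : x ∈ 𝒜 e) (hreg : IsSMulRegular R x) :
    IsSMulRegular M x := by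
  have hd := hM.depth_eq
  rw [h.ringKrullDim_eq] at hd
  obtain ⟨rs, ⟨hI, hrs⟩, hne⟩ : ∃ rs ∈ {rs : List R | (∀ r ∈ rs, r ∈ irrelevantIdeal 𝒜) ∧
      RingTheory.Sequence.IsRegular M rs}, rs ≠ [] := by
    by_contra! hcon
    have h0 : depth (irrelevantIdeal 𝒜) M ≤ 0 :=
      iSup₂_le fun rs hrs => by rw [hcon rs hrs, List.length_nil, Nat.cast_zero]
    rw [nonpos_iff_eq_zero.mp h0] at hd
    exact absurd hd (by simp)
  obtain ⟨r, rs, rfl⟩ := List.exists_cons_of_ne_nil hne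
  have hr := ((RingTheory.Sequence.isRegular_cons_iff M r rs).mp hrs).1
  obtain ⟨N, hN⟩ := h.exists_pow_mem hx hreg (hI r (by simp))
  obtain ⟨z, hz⟩ := Ideal.mem_span_singleton'.mp hN
  have := hr.pow N
  rw [← hz] at this
  exact this.of_mul

/-- The length of a regular sequence is at most the dimension of the support, hence at most one.
Conversely `[x]` is regular: `xM = M` would give some `1 + X * s` killing the nonzero torsion-free
`K[X]`-module `M`. -/
theorem isMCM_of_isSMulRegular {M : Type*} [AddCommGroup M] [Module R M] {ℳ : ℤ → AddSubgroup M}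
    (hM : IsGradedModule 𝒜 ℳ) [Module.Finite R M] [Nontrivial M] {x : R} {e : ℤ} (he : 0 < e)
    (hx : x ∈ 𝒜 e) (hreg : IsSMulRegular R x) (hxM : IsSMulRegular M x) : IsMCM 𝒜 ℳ where
  graded := hM
  finite := inferInstance
  nontrivial := inferInstance
  depth_eq := by
    have := h.isNoetherianRing
    rw [h.ringKrullDim_eq]
    have hle : depth (irrelevantIdeal 𝒜) M ≤ 1 := by
      refine iSup₂_le fun rs hrs => ?_
      have h1 := (length_le_supportDim_of_isRegular hrs.2).trans
        (Module.supportDim_le_ringKrullDim R M)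
      rw [h.ringKrullDim_eq] at h1
      exact_mod_cast h1
    have hge : 1 ≤ depth (irrelevantIdeal 𝒜) M := by
      let _ : Algebra K[X] R := (aeval x).toAlgebra
      let _ : Module K[X] M := Module.compHom M (algebraMap K[X] R)
      have : IsScalarTower K[X] R M := ⟨fun p r m => by
        rw [Algebra.smul_def, mul_smul]; rfl⟩
      have : IsScalarTower K K[X] R := IsScalarTower.of_algebraMap_eq fun c => by
        change _ = aeval x (C c)
        rw [aeval_C]
      have hxX : algebraMap K[X] R X = x := aeval_X x
      have hfin := h.finite_polynomial he hxX hx hreg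
      have hMfin : Module.Finite K[X] M := Module.Finite.trans R M
      have hXx : ∀ m : M, (X : K[X]) • m = x • m := fun m => by rw [← hxX, algebraMap_smul]
      have hX : IsSMulRegular M (X : K[X]) := fun m m' hm => hxM (by simpa only [hXx] using hm)
      refine le_iSup₂_of_le [x] ⟨?_, ?_⟩ (by simp)
      · intro r hr
        rw [List.mem_singleton.mp hr]
        exact Ideal.subset_span ⟨e, he, hx⟩
      · refine ⟨(RingTheory.Sequence.isWeaklyRegular_singleton_iff M x).mpr hxM, ?_⟩
        intro htop
        rw [Ideal.ofList_singleton] at htop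
        obtain ⟨r, hr, hr0⟩ := Submodule.exists_sub_one_mem_and_smul_eq_zero_of_fg_of_le_smul
          (Ideal.span {(X : K[X])}) (⊤ : Submodule K[X] M) Module.Finite.fg_top (by
            rintro m -
            have hm : m ∈ Ideal.span {x} • (⊤ : Submodule R M) := htop ▸ trivial
            rw [Submodule.ideal_span_singleton_smul, Submodule.mem_smul_pointwise_iff_exists] at hm ⊢
            obtain ⟨m', -, rfl⟩ := hm
            exact ⟨m', trivial, hXx m'⟩)
        obtain ⟨s, rfl⟩ := exists_one_add_X_mul hr
        obtain ⟨m, hm⟩ := exists_ne (0 : M)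
        refine hm (eq_zero_of_smul_eq_zero he
          (hM.polynomial h.graded h.algebraMap_mem (hxX ▸ hx)) hX (fun h0 => ?_) (hr0 m trivial))
        simpa using congrArg (fun p : K[X] => p.coeff 0) h0
    rw [le_antisymm hle hge]
    rfl

end IsGradedCurve

theorem mem_iff_apply_mem {R : Type*} [CommRing R] {𝒜 : ℤ → AddSubgroup R} {M Ω : Type*}
    [AddCommGroup M] [Module R M] [AddCommGroup Ω] [Module R Ω] {ℳ : ℤ → AddSubgroup M}
    {𝒲 : ℤ → AddSubgroup Ω} (hM : IsGradedModule 𝒜 ℳ)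
    (hW : DirectSum.IsInternal 𝒲) (hD : IsGradedModule 𝒜 (homGrading (R := R) ℳ 𝒲))
    (hinj : Function.Injective (LinearMap.applyₗ : M →ₗ[R] (M →ₗ[R] Ω) →ₗ[R] Ω)) (k : ℤ) (m : M) :
    m ∈ ℳ k ↔ (LinearMap.applyₗ m : (M →ₗ[R] Ω) →ₗ[R] Ω) ∈
      homGrading (R := R) (homGrading (R := R) ℳ 𝒲) 𝒲 k := by
  constructor
  · intro hm j φ hφ
    rw [LinearMap.applyₗ_apply_apply, add_comm]
    exact hφ k m hm
  · intro hm
    -- For `i ≠ k` and `φ` of degree `j`, the value of `φ` at the component `m_i` is the part of `φ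
    -- m` in degree `i + j`. It vanishes because `φ m` lies in degree `j + k`; injectivity of
    -- evaluation then gives `m_i = 0`.
    refine mem_of_component hM.isInternal fun i hi => hinj ?_
    rw [map_zero]
    refine linearMap_eq_zero_of_homogeneous hD fun j φ hφ => ?_
    have h1 : component hW (i + j) (φ m) = 0 :=
      component_of_mem_ne hW (by omega) (hm j φ hφ)
    rw [LinearMap.applyₗ_apply_apply, ← h1]
    generalize m = m'
    induction m' using homogeneous_induction hM.isInternal with
    | zero => simp
    | add m m' hm hm' => simp only [map_add, hm, hm']
    | homogeneous l m hm =>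
      by_cases hl : l = i
      · subst hl
        rw [component_of_mem _ hm, component_of_mem _ (hφ l m hm)]
      · rw [component_of_mem_ne _ hl hm, component_of_mem_ne _ (by simpa using hl) (hφ l m hm),
          map_zero]

end GradedDuality

namespace GradedDuality

open Polynomial

/-! ### Duality over a graded curve -/

section CurveDuality

variable {K : Type u} [Field K] {R : Type u} [CommRing R] [Algebra K R] {𝒜 : ℤ → AddSubgroup R}

theorem duality_of_isGradedCurve (h : IsGradedCurve K 𝒜) (Ω : Type w) [AddCommGroup Ω] [Module R Ω]
    (𝒲 : ℤ → AddSubgroup Ω) (hΩ : IsDualizing K 𝒜 𝒲) :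
    (∀ (M : Type v) [AddCommGroup M] [Module R M] (ℳ : ℤ → AddSubgroup M), IsMCM 𝒜 ℳ →
      IsMCM 𝒜 (homGrading (R := R) ℳ 𝒲) ∧ Nontrivial (M →ₗ[R] Ω) ∧
      ∀ x : R, IsSMulRegular M x → IsSMulRegular R x →
        IsSMulRegular (M →ₗ[R] Ω) x ∧
        ∃ ε : ModElt x (M →ₗ[R] Ω) ≃ₗ[R ⧸ Ideal.span {x}]
            (ModElt x M →ₗ[R ⧸ Ideal.span {x}] ModElt x Ω),
          (∀ (φ : M →ₗ[R] Ω) (m : M), ε (toModElt x φ) (toModElt x m) = toModElt x (φ m)) ∧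
          ∀ e : ℤ, x ∈ 𝒜 e → ∀ (k : ℤ) (a : ModElt x (M →ₗ[R] Ω)),
            a ∈ modGrading x (homGrading (R := R) ℳ 𝒲) k ↔
              ε a ∈ homGrading (R := R ⧸ Ideal.span {x})
                (modGrading x ℳ) (modGrading x 𝒲) k) ∧
    (∀ (M₁ M₂ M₃ : Type v) [AddCommGroup M₁] [AddCommGroup M₂] [AddCommGroup M₃]
        [Module R M₁] [Module R M₂] [Module R M₃] (ℳ₃ : ℤ → AddSubgroup M₃),
      IsMCM 𝒜 ℳ₃ → ∀ (g : M₁ →ₗ[R] M₂) (h : M₂ →ₗ[R] M₃),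
        Function.Injective g → Function.Exact g h → Function.Surjective h →
          Function.Injective (LinearMap.lcomp R Ω h) ∧
          Function.Exact (LinearMap.lcomp R Ω h) (LinearMap.lcomp R Ω g) ∧
          Function.Surjective (LinearMap.lcomp R Ω g)) ∧
    (∀ (M : Type v) [AddCommGroup M] [Module R M] (ℳ : ℤ → AddSubgroup M), IsMCM 𝒜 ℳ →
      Function.Bijective (LinearMap.applyₗ : M →ₗ[R] (M →ₗ[R] Ω) →ₗ[R] Ω) ∧
      ∀ (k : ℤ) (m : M), m ∈ ℳ k ↔
        (LinearMap.applyₗ m : (M →ₗ[R] Ω) →ₗ[R] Ω) ∈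
          homGrading (R := R) (homGrading (R := R) ℳ 𝒲) 𝒲 k) := by
  obtain ⟨hW, hΩfin, e, x, he, hx, hxR, hxΩ, ε, hε, hεgr⟩ := hΩ
  have hnoeth := h.isNoetherianRing
  let _ : Algebra K[X] R := (aeval x).toAlgebra
  have htowK : IsScalarTower K K[X] R := IsScalarTower.of_algebraMap_eq fun c => by
    change _ = aeval x (C c)
    rw [aeval_C]
  have hxX : algebraMap K[X] R X = x := aeval_X x
  have hRfin := h.finite_polynomial he hxX hx hxR
  let _ : Module K[X] Ω := Module.compHom Ω (algebraMap K[X] R)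
  have htowΩ : IsScalarTower K[X] R Ω := ⟨fun p r m => by rw [Algebra.smul_def, mul_smul]; rfl⟩
  have hΩfin' : Module.Finite K[X] Ω := Module.Finite.trans R Ω
  obtain ⟨lam, hlam⟩ := exists_isPerfectForm h.graded he h.algebraMap_mem hxX hx hW hxΩ ε hε hεgr
  have hfree : ∀ (M : Type v) [AddCommGroup M] [Module R M] [Module K[X] M] [IsScalarTower K[X] R M]
      (ℳ : ℤ → AddSubgroup M), IsMCM 𝒜 ℳ → Module.Finite K[X] M ∧ Module.Free K[X] M := by
    intro M _ _ _ _ ℳ hM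
    have hfin := hM.finite
    have hfin' : Module.Finite K[X] M := Module.Finite.trans R M
    have hXx : ∀ m : M, (X : K[X]) • m = x • m := fun m => by rw [← hxX, algebraMap_smul]
    have hxM := h.isSMulRegular_of_isMCM hM hx hxR
    exact ⟨hfin', free_of_isSMulRegular he
      (hM.graded.polynomial h.graded h.algebraMap_mem (hxX ▸ hx))
      fun m m' hm => hxM (by simpa only [hXx] using hm)⟩
  have htow : ∀ (M : Type v) [AddCommGroup M] [Module R M],
      letI : Module K[X] M := Module.compHom M (algebraMap K[X] R)
      IsScalarTower K[X] R M := by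
    intro M _ _
    let _ : Module K[X] M := Module.compHom M (algebraMap K[X] R)
    exact ⟨fun p r m => by rw [Algebra.smul_def, mul_smul]; rfl⟩
  have hregHom : ∀ {y : R}, IsSMulRegular Ω y → ∀ (M : Type v) [AddCommGroup M] [Module R M],
      IsSMulRegular (M →ₗ[R] Ω) y := fun hy M _ _ φ ψ hφψ =>
    LinearMap.ext fun m => hy (LinearMap.congr_fun hφψ m)
  refine ⟨?_, ?_, ?_⟩
  · intro M _ _ ℳ hM
    let _ : Module K[X] M := Module.compHom M (algebraMap K[X] R)
    have := htow M
    have hMfin := hM.finite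
    obtain ⟨hfin', hfree'⟩ := hfree M ℳ hM
    have hnt : Nontrivial (M →ₗ[R] Ω) := by
      have := hM.nontrivial
      obtain ⟨m, hm⟩ := exists_ne (0 : M)
      obtain ⟨μ, hμ⟩ : ∃ μ : Module.Dual K[X] M, μ m ≠ 0 := by
        by_contra! hcon
        exact hm ((Module.forall_dual_apply_eq_zero_iff K[X] m).mp hcon)
      obtain ⟨φ, hφ⟩ := hlam.exists_hom μ
      refine ⟨φ, 0, fun h0 => hμ ?_⟩
      rw [← hφ, h0, LinearMap.zero_apply, map_zero]
    have hDfin := finite_linearMap (R := R) M Ω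
    refine ⟨h.isMCM_of_isSMulRegular (homGrading_isGradedModule h.graded hM.graded hW) he hx hxR
      (hregHom hxΩ M), hnt, fun y _ hyR => ?_⟩
    -- Here `y` is an arbitrary nonzerodivisor, unrelated to the parameter `x` that defines the
    -- `K[X]`-structure.
    have hyΩ := hlam.isSMulRegular hyR
    obtain ⟨η, hη⟩ := exists_reduction_equiv hyΩ fun ψ : M →ₗ[R] ModElt y Ω =>
      hlam.exists_lift_modElt hyΩ ψ
    exact ⟨hregHom hyΩ M, η, hη, fun d hy k a =>
      mem_modGrading_homGrading_iff h.graded hM.graded hW η hη hy k a⟩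
  · intro M₁ M₂ M₃ _ _ _ _ _ _ ℳ₃ hM₃ g q hg hgq hq
    let _ : Module K[X] M₁ := Module.compHom M₁ (algebraMap K[X] R)
    let _ : Module K[X] M₂ := Module.compHom M₂ (algebraMap K[X] R)
    let _ : Module K[X] M₃ := Module.compHom M₃ (algebraMap K[X] R)
    have := htow M₁
    have := htow M₂
    have := htow M₃
    obtain ⟨hfin', hfree'⟩ := hfree M₃ ℳ₃ hM₃
    refine ⟨fun φ ψ hφψ => (LinearMap.cancel_right hq).mp hφψ, ?_,
      fun φ => hlam.exists_extension hg hgq hq φ⟩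
    exact LinearMap.exact_lcomp_of_exact_of_surjective Ω hgq hq
  · intro M _ _ ℳ hM
    let _ : Module K[X] M := Module.compHom M (algebraMap K[X] R)
    have := htow M
    have hMfin := hM.finite
    obtain ⟨hfin', hfree'⟩ := hfree M ℳ hM
    have hbij := hlam.bijective_eval (M := M)
    exact ⟨hbij, mem_iff_apply_mem hM.graded hW.isInternal
      (homGrading_isGradedModule h.graded hM.graded hW) hbij.1⟩

end CurveDuality

/-! ### Dualizing modules from socle forms -/

/-- The pairing `(s, t) ↦ θ (s * t)` embeds `R/xR` in its dual, and equality of finite dimensions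
makes the embedding bijective. -/
theorem exists_modElt_equiv_dual {K R : Type*} [Field K] [CommRing R] [Algebra K R] (x : R)
    [Module.Finite K (R ⧸ Ideal.span {x})] (θ : R →ₗ[K] K) (hθx : ∀ t, θ (x * t) = 0)
    (hθ : ∀ s, (∀ t, θ (s * t) = 0) → s ∈ Ideal.span {x}) :
    ∃ ε : ModElt x R ≃+ Module.Dual K (R ⧸ Ideal.span {x}),
      ∀ w a, ε (toModElt x w) (Ideal.Quotient.mk _ a) = θ (w * a) := by
  let θ' : (R ⧸ Ideal.span {x}) →ₗ[K] K :=
    Submodule.liftQ ((Ideal.span {x} : Ideal R).restrictScalars K) θ (by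
      intro t ht
      obtain ⟨s, rfl⟩ := Ideal.mem_span_singleton'.mp ht
      rw [LinearMap.mem_ker, mul_comm, hθx])
  have hθ' : ∀ t, θ' (Ideal.Quotient.mk _ t) = θ t := fun t => rfl
  let P : (R ⧸ Ideal.span {x}) →ₗ[K] Module.Dual K (R ⧸ Ideal.span {x}) :=
    (LinearMap.mul K (R ⧸ Ideal.span {x})).compr₂ θ'
  have hP : ∀ s t, P (Ideal.Quotient.mk _ s) (Ideal.Quotient.mk _ t) = θ (s * t) := fun s t => rfl
  have hinj : Function.Injective P := by
    rw [injective_iff_map_eq_zero]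
    intro a ha
    obtain ⟨s, rfl⟩ := Ideal.Quotient.mk_surjective a
    refine Ideal.Quotient.eq_zero_iff_mem.mpr (hθ s fun t => ?_)
    rw [← hP, ha, LinearMap.zero_apply]
  let E := LinearMap.linearEquivOfInjective P hinj (Subspace.dual_finrank_eq).symm
  have hspan : (Ideal.span {x} • (⊤ : Submodule R R)) = (Ideal.span {x} : Ideal R) := by
    rw [smul_eq_mul, Ideal.mul_top]
  exact ⟨(Submodule.quotEquivOfEq _ _ hspan).toAddEquiv.trans E.toAddEquiv, fun w a => rfl⟩

end GradedDuality

namespace GradedDuality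

open MvPolynomial

/-! ### The graded ring `K[x_0, …, x_n] / (f_1, …, f_n)` -/

section CompleteIntersection

variable {K : Type u} [Field K] {n : ℕ} {f : Fin n → MvPolynomial (Fin (n + 1)) K}

theorem CIRing.mk_surjective : Function.Surjective (CIRing.mk f) := Ideal.Quotient.mk_surjective

theorem CIRing.mk_eq_zero_iff {p : MvPolynomial (Fin (n + 1)) K} :
    CIRing.mk f p = 0 ↔ p ∈ Ideal.span (Set.range f) := Ideal.Quotient.eq_zero_iff_mem

theorem CIRing.mk_C (c : K) : CIRing.mk f (C c) = algebraMap K (CIRing f) c := rfl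

theorem mem_ciGrading_natCast {k : ℕ} {t : CIRing f} :
    t ∈ ciGrading f k ↔ ∃ p, p.IsHomogeneous k ∧ CIRing.mk f p = t := by
  rw [ciGrading, if_pos (Int.natCast_nonneg k), Int.toNat_natCast]
  rfl

theorem eq_zero_of_mem_ciGrading {k : ℤ} (hk : k < 0) {t : CIRing f} (ht : t ∈ ciGrading f k) :
    t = 0 := by
  rw [ciGrading, if_neg (not_le.mpr hk)] at ht
  exact ht

theorem ofList_ofFn : Ideal.ofList (List.ofFn f) = Ideal.span (Set.range f) := by
  rw [Ideal.ofList]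
  congr 1
  ext p
  exact List.mem_ofFn

theorem homogeneousComponent_mem_span {d : Fin n → ℕ} (hf : ∀ i, (f i).IsHomogeneous (d i))
    {p : MvPolynomial (Fin (n + 1)) K} (hp : p ∈ Ideal.span (Set.range f)) (N : ℕ) :
    homogeneousComponent N p ∈ Ideal.span (Set.range f) := by
  rw [← ofList_ofFn] at hp ⊢
  refine homogeneousComponent_mem_ofList (fun q hq => ?_) hp N
  obtain ⟨i, rfl⟩ := List.mem_ofFn.mp hq
  exact ⟨d i, hf i⟩

theorem ciGrading_isInternal {d : Fin n → ℕ} (hf : ∀ i, (f i).IsHomogeneous (d i)) :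
    DirectSum.IsInternal (ciGrading f) := by
  classical
  let q : ℕ → CIRing f →+ CIRing f := fun k =>
    (CIRing.mk f).toAddMonoidHom.liftOfRightInverse _ (Function.rightInverse_surjInv
      CIRing.mk_surjective)
      ⟨(CIRing.mk f).toAddMonoidHom.comp (homogeneousComponent k).toAddMonoidHom, fun p hp =>
        CIRing.mk_eq_zero_iff.mpr
          (homogeneousComponent_mem_span hf (CIRing.mk_eq_zero_iff.mp hp) k)⟩
  have hq : ∀ k p, q k (CIRing.mk f p) = CIRing.mk f (homogeneousComponent k p) := fun k p =>
    AddMonoidHom.liftOfRightInverse_comp_apply _ _ _ _ p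
  let r : ℤ → CIRing f →+ CIRing f := fun k => if 0 ≤ k then q k.toNat else 0
  have hr : ∀ k : ℕ, r k = q k := fun k => by
    simp only [r, if_pos (Int.natCast_nonneg k), Int.toNat_natCast]
  have hr' : ∀ k : ℤ, k < 0 → r k = 0 := fun k hk => if_neg (not_le.mpr hk)
  refine isInternal_of_components r ?_ ?_ ?_ ?_
  · intro k t
    obtain ⟨p, rfl⟩ := CIRing.mk_surjective t
    rcases lt_or_ge k 0 with hk | hk
    · rw [hr' k hk]
      exact zero_mem _
    · lift k to ℕ using hk
      rw [hr, hq]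
      exact mem_ciGrading_natCast.mpr ⟨_, homogeneousComponent_isHomogeneous k p, rfl⟩
  · intro k t ht
    rcases lt_or_ge k 0 with hk | hk
    · rw [eq_zero_of_mem_ciGrading hk ht, map_zero]
    · lift k to ℕ using hk
      obtain ⟨p, hp, rfl⟩ := mem_ciGrading_natCast.mp ht
      rw [hr, hq, homogeneousComponent_eq_self hp]
  · intro j k hjk t ht
    rcases lt_or_ge k 0 with hk | hk
    · rw [hr' k hk]
      rfl
    rcases lt_or_ge j 0 with hj | hj
    · rw [eq_zero_of_mem_ciGrading hj ht, map_zero]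
    lift k to ℕ using hk
    lift j to ℕ using hj
    obtain ⟨p, hp, rfl⟩ := mem_ciGrading_natCast.mp ht
    rw [hr, hq, homogeneousComponent_of_mem hp, if_neg, map_zero]
    rintro rfl
    exact hjk rfl
  · intro t
    obtain ⟨p, rfl⟩ := CIRing.mk_surjective t
    refine ⟨(Finset.range (p.totalDegree + 1)).image Nat.cast, ?_⟩
    rw [Finset.sum_image fun i _ j _ h => Nat.cast_injective h]
    rw [Finset.sum_congr rfl fun k _ => by rw [hr, hq], ← map_sum, sum_homogeneousComponent]

theorem ciGrading_isGradedModule {d : Fin n → ℕ} (hf : ∀ i, (f i).IsHomogeneous (d i)) :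
    IsGradedModule (ciGrading f) (ciGrading f) where
  isInternal := ciGrading_isInternal hf
  smul_mem i j s t hs ht := by
    rcases lt_or_ge i 0 with hi | hi
    · rw [eq_zero_of_mem_ciGrading hi hs, zero_smul]
      exact zero_mem _
    rcases lt_or_ge j 0 with hj | hj
    · rw [eq_zero_of_mem_ciGrading hj ht, smul_zero]
      exact zero_mem _
    lift i to ℕ using hi
    lift j to ℕ using hj
    obtain ⟨p, hp, rfl⟩ := mem_ciGrading_natCast.mp hs
    obtain ⟨q, hq, rfl⟩ := mem_ciGrading_natCast.mp ht
    rw [smul_eq_mul, ← map_mul, ← Nat.cast_add]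
    exact mem_ciGrading_natCast.mpr ⟨_, hp.mul hq, rfl⟩

/-- A nonzero constant term would force degree `0`, making `p` a unit in a proper ideal. -/
theorem mem_varIdeal_of_isHomogeneous {p : MvPolynomial (Fin (n + 1)) K} {d : ℕ}
    (hp : p.IsHomogeneous d) {I : Ideal (MvPolynomial (Fin (n + 1)) K)} (hI : I ≠ ⊤) (hpI : p ∈ I) :
    p ∈ varIdeal K (Fin (n + 1)) := by
  have h0 : coeff 0 p = 0 := by
    by_contra h
    have hd : d = 0 := by
      have := hp h
      simpa using this.symm
    subst hd
    have hpC : p = C (coeff 0 p) := by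
      rw [← homogeneousComponent_zero, homogeneousComponent_eq_self hp]
    rw [hpC] at hpI
    exact hI (Ideal.eq_top_of_isUnit_mem _ hpI ((isUnit_iff_ne_zero.mpr h).map C))
  rw [varIdeal, ← Set.image_univ, mem_ideal_span_X_image]
  intro m hm
  by_contra! hcon
  have : m = 0 := Finsupp.ext fun i => hcon i trivial
  rw [this] at hm
  exact mem_support_iff.mp hm h0

theorem regularSeqMod_ofFn
    (hreg : RingTheory.Sequence.IsRegular (MvPolynomial (Fin (n + 1)) K) (List.ofFn f)) :
    RegularSeqMod ⊥ (List.ofFn f) := by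
  refine regularSeqMod_of_isWeaklyRegular fun i hi => ?_
  rw [regularMod_iff_isSMulRegular, bot_sup_eq]
  have := hreg.regular_mod_prev i hi
  rwa [smul_eq_mul, Ideal.mul_top] at this

theorem span_range_ne_top
    (hreg : RingTheory.Sequence.IsRegular (MvPolynomial (Fin (n + 1)) K) (List.ofFn f)) :
    Ideal.span (Set.range f) ≠ ⊤ := by
  have := hreg.top_ne_smul
  rw [smul_eq_mul, Ideal.mul_top, ofList_ofFn] at this
  exact this.symm

theorem isSMulRegular_mk_iff {g : MvPolynomial (Fin (n + 1)) K} :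
    IsSMulRegular (CIRing f) (CIRing.mk f g) ↔ RegularMod (Ideal.span (Set.range f)) g := by
  rw [isSMulRegular_iff_right_eq_zero_of_smul]
  constructor
  · intro h s hs
    exact CIRing.mk_eq_zero_iff.mp (h (CIRing.mk f s) (by
      rw [smul_eq_mul, ← map_mul]
      exact CIRing.mk_eq_zero_iff.mpr hs))
  · intro h t ht
    obtain ⟨s, rfl⟩ := CIRing.mk_surjective t
    rw [smul_eq_mul, ← map_mul] at ht
    exact CIRing.mk_eq_zero_iff.mpr (h s (CIRing.mk_eq_zero_iff.mp ht))

theorem exists_linForm_isSMulRegular [Infinite K] {d : Fin n → ℕ}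
    (hf : ∀ i, (f i).IsHomogeneous (d i))
    (hreg : RingTheory.Sequence.IsRegular (MvPolynomial (Fin (n + 1)) K) (List.ofFn f)) :
    ∃ v : Fin (n + 1) → K, IsSMulRegular (CIRing f) (CIRing.mk f (linForm v)) := by
  have h1 := socleFree_of_regularSeqMod (List.length_ofFn) (regularSeqMod_ofFn hreg) (by
    intro p hp
    obtain ⟨i, rfl⟩ := List.mem_ofFn.mp hp
    exact mem_varIdeal_of_isHomogeneous (hf i) (span_range_ne_top hreg)
      (Ideal.subset_span ⟨i, rfl⟩))
  obtain ⟨v, -, hv⟩ := exists_linForm_regularMod [Ideal.ofList (List.ofFn f)]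
    (by simpa using h1) ⊥ bot_ne_top
  refine ⟨v, isSMulRegular_mk_iff.mpr ?_⟩
  rw [← ofList_ofFn]
  exact hv _ (by simp)

theorem linForm_mem_ciGrading (v : Fin (n + 1) → K) :
    CIRing.mk f (linForm v) ∈ ciGrading f 1 := by
  rw [show (1 : ℤ) = (1 : ℕ) from rfl]
  exact mem_ciGrading_natCast.mpr ⟨_, linForm_isHomogeneous v, rfl⟩

/-- The `n` members of the regular sequence lower the dimension `n + 1` to at most one. It is at
least one because a regular linear form generates a proper ideal of `T`. -/
theorem ciRing_isGradedCurve [Infinite K] {d : Fin n → ℕ}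
    (hf : ∀ i, (f i).IsHomogeneous (d i))
    (hreg : RingTheory.Sequence.IsRegular (MvPolynomial (Fin (n + 1)) K) (List.ofFn f)) :
    IsGradedCurve K (ciGrading f) where
  graded := ciGrading_isGradedModule hf
  algebraMap_mem c := by
    rw [← CIRing.mk_C, show (0 : ℤ) = (0 : ℕ) from rfl]
    exact mem_ciGrading_natCast.mpr ⟨_, isHomogeneous_C _ c, rfl⟩
  eq_zero_of_neg k hk t ht := eq_zero_of_mem_ciGrading hk ht
  finiteType := inferInstanceAs (Algebra.FiniteType K
    (MvPolynomial (Fin (n + 1)) K ⧸ Ideal.span (Set.range f)))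
  ringKrullDim_eq := by
    apply le_antisymm
    · have h1 := ringKrullDim_ofList_add_length_le (regularSeqMod_ofFn hreg)
      rw [ringKrullDim_of_isNoetherianRing, ringKrullDim_eq_zero_of_field, zero_add,
        Nat.card_eq_fintype_card, Fintype.card_fin, List.length_ofFn, ofList_ofFn] at h1
      change ringKrullDim (CIRing f) + n ≤ _ at h1
      generalize ringKrullDim (CIRing f) = D at h1 ⊢
      induction D using WithBot.recBotCoe with
      | bot => exact bot_le
      | coe D =>
        have h1 : D + n ≤ (n + 1 : ℕ) := by exact_mod_cast h1
        lift D to ℕ using fun hD => by simp [hD] at h1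
        have h2 : D + n ≤ n + 1 := by exact_mod_cast h1
        have h3 : D ≤ 1 := by omega
        exact_mod_cast h3
    · obtain ⟨v, hv⟩ := exists_linForm_isSMulRegular hf hreg
      have h1 := ringKrullDim_quotient_succ_le_of_nonZeroDivisor (r := CIRing.mk f (linForm v)) (by
        rw [mem_nonZeroDivisors_iff_right]
        intro a ha
        exact hv (by simpa [mul_comm] using ha))
      have hne : Ideal.span {CIRing.mk f (linForm v)} ≠ ⊤ := by
        intro htop
        obtain ⟨t, ht⟩ := Ideal.mem_span_singleton'.mp ((Ideal.eq_top_iff_one _).mp htop)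
        obtain ⟨p, rfl⟩ := CIRing.mk_surjective t
        rw [← map_mul, ← sub_eq_zero, ← map_one (CIRing.mk f), ← map_sub,
          CIRing.mk_eq_zero_iff] at ht
        have h2 : p * linForm v - 1 ∈ varIdeal K (Fin (n + 1)) := by
          refine (Ideal.span_le.mpr ?_ : Ideal.span (Set.range f) ≤ varIdeal K _) ht
          rintro _ ⟨i, rfl⟩
          exact mem_varIdeal_of_isHomogeneous (hf i) (span_range_ne_top hreg)
            (Ideal.subset_span ⟨i, rfl⟩)
        have h3 : (1 : MvPolynomial (Fin (n + 1)) K) ∈ varIdeal K (Fin (n + 1)) := by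
          have := sub_mem (Ideal.mul_mem_left _ p (linForm_mem_varIdeal v)) h2
          rwa [sub_sub_cancel] at this
        rw [varIdeal, ← Set.image_univ, mem_ideal_span_X_image] at h3
        obtain ⟨i, -, hi⟩ := h3 0 (by simp)
        exact hi rfl
      have hnt : Nontrivial (CIRing f ⧸ Ideal.span {CIRing.mk f (linForm v)}) :=
        Ideal.Quotient.nontrivial_iff.mpr hne
      calc (1 : WithBot ℕ∞) = 0 + 1 := (zero_add 1).symm
        _ ≤ _ := add_le_add_left ringKrullDim_nonneg_of_nontrivial 1
        _ ≤ _ := h1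

theorem isDualizing_shift [Infinite K] {d : Fin n → ℕ}
    (hf : ∀ i, (f i).IsHomogeneous (d i))
    (hreg : RingTheory.Sequence.IsRegular (MvPolynomial (Fin (n + 1)) K) (List.ofFn f)) :
    IsDualizing K (ciGrading f) (shift (ciGrading f) (∑ i, (d i : ℤ) - n - 1)) := by
  have hT := ciRing_isGradedCurve hf hreg
  obtain ⟨v, hv⟩ := exists_linForm_isSMulRegular hf hreg
  have hfin := hT.finite_quotient hv
  let fs : List (MvPolynomial (Fin (n + 1)) K × ℕ) :=
    List.ofFn (fun i => (f i, d i)) ++ [(linForm v, 1)]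
  have hfst : fs.map Prod.fst = List.ofFn f ++ [linForm v] := by
    rw [List.map_append, List.map_ofFn, List.map_singleton]
    rfl
  -- The sequence `f_1, …, f_n, ℓ`, starting with no powers of linear forms. The degree `1` of `ℓ`
  -- contributes `0`, so the socle degree is `∑ d i - n`.
  have hsocle := hasSocleForm_of_regularSeqMod fs (k := 0) (by simp [fs]) (v := Fin.elim0)
    (linearIndependent_empty_type) (N := Fin.elim0) (fun i => i.elim0) (by
      intro p hp
      rcases List.mem_append.mp hp with h | h
      · obtain ⟨i, rfl⟩ := List.mem_ofFn.mp h
        exact ⟨hf i, mem_varIdeal_of_isHomogeneous (hf i) (span_range_ne_top hreg)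
          (Ideal.subset_span ⟨i, rfl⟩)⟩
      · rw [List.mem_singleton.mp h]
        exact ⟨linForm_isHomogeneous v, linForm_mem_varIdeal v⟩) (by
      rw [List.ofFn_zero, List.nil_append, hfst, regularSeqMod_append_singleton, bot_sup_eq,
        ofList_ofFn]
      exact ⟨regularSeqMod_ofFn hreg, isSMulRegular_mk_iff.mp hv⟩)
  rw [List.ofFn_zero, List.nil_append, hfst, Ideal.ofList_append, Ideal.ofList_singleton,
    ofList_ofFn, Finset.univ_eq_empty, Finset.sum_empty, zero_add, List.map_append, List.map_ofFn,
    List.sum_append, List.sum_ofFn, List.map_singleton, List.sum_singleton] at hsocle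
  obtain ⟨θ, h1, h2, h3⟩ := hsocle
  let θT : CIRing f →ₗ[K] K :=
    Submodule.liftQ ((Ideal.span (Set.range f)).restrictScalars K) θ fun p hp =>
      h1 p (Ideal.mem_sup_left hp)
  have hθT : ∀ p, θT (CIRing.mk f p) = θ p := fun p => rfl
  obtain ⟨ε, hε⟩ := exists_modElt_equiv_dual (CIRing.mk f (linForm v)) θT (by
      intro t
      obtain ⟨p, rfl⟩ := CIRing.mk_surjective t
      rw [← map_mul, hθT]
      exact h1 _ (Ideal.mul_mem_right _ _ (Ideal.mem_sup_right (Ideal.mem_span_singleton_self _))))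
    (by
      intro s hs
      obtain ⟨p, rfl⟩ := CIRing.mk_surjective s
      obtain ⟨q, hq, a, ha⟩ := mem_sup_span_singleton.mp (h3 p fun t => by
        rw [← hθT, map_mul]
        exact hs _)
      rw [ha, map_add, CIRing.mk_eq_zero_iff.mpr hq, zero_add, map_mul]
      exact Ideal.mul_mem_right _ _ (Ideal.mem_span_singleton_self _))
  refine ⟨hT.graded.shift _, inferInstance, 1, CIRing.mk f (linForm v), one_pos,
    linForm_mem_ciGrading v, hv, hv, ε, ?_, ?_⟩
  · intro r w a
    obtain ⟨w, rfl⟩ := toModElt_surjective w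
    obtain ⟨a, rfl⟩ := Ideal.Quotient.mk_surjective a
    have e1 : r • toModElt (CIRing.mk f (linForm v)) w =
      toModElt (CIRing.mk f (linForm v)) (r * w) := rfl
    have e2 : r • Ideal.Quotient.mk (Ideal.span {CIRing.mk f (linForm v)}) a =
      Ideal.Quotient.mk (Ideal.span {CIRing.mk f (linForm v)}) (r * a) := rfl
    rw [e1, e2, hε, hε]
    congr 1
    ring
  · intro i j w a hw ha hij
    rw [hε]
    -- With `e = 1`, the product has degree `τ + i + j`, which is the socle degree `τ + 1` exactly
    -- when `i + j = e`.
    have hwa : w * a ∈ ciGrading f (∑ i, (d i : ℤ) - n - 1 + i + j) :=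
      hT.graded.smul_mem _ _ _ _ hw ha
    rcases lt_or_ge (∑ i, (d i : ℤ) - n - 1 + i + j) 0 with hneg | hpos
    · rw [eq_zero_of_mem_ciGrading hneg hwa, map_zero]
    · obtain ⟨k, hk⟩ := Int.eq_ofNat_of_zero_le hpos
      rw [hk] at hwa
      obtain ⟨p, hp, hpw⟩ := mem_ciGrading_natCast.mp hwa
      rw [← hpw, hθT]
      refine h2 k p hp ?_
      rw [← hk]
      simp only [Function.comp_apply, Finset.sum_sub_distrib, Finset.sum_const, Finset.card_univ,
        Fintype.card_fin, nsmul_eq_mul, mul_one, Nat.cast_one, sub_self, add_zero]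
      omega

end CompleteIntersection

end GradedDuality

open GradedDuality in
theorem theorem2p4 {K : Type u} [Field K] [IsAlgClosed K] (n : ℕ)
    (f : Fin n → MvPolynomial (Fin (n + 1)) K) (d : Fin n → ℕ)
    (hf : ∀ i, (f i).IsHomogeneous (d i))
    (hreg : RingTheory.Sequence.IsRegular (MvPolynomial (Fin (n + 1)) K) (List.ofFn f)) :
    -- `T[τ]`, with `τ = d_1 + ⋯ + d_n - n - 1`, is a dualizing module of `T`
    IsDualizing K (ciGrading f) (shift (ciGrading f) (∑ i, (d i : ℤ) - n - 1)) ∧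
    -- for every dualizing module `Ω` of `T`:
    ∀ (Ω : Type w) [AddCommGroup Ω] [Module (CIRing f) Ω] (𝒲 : ℤ → AddSubgroup Ω),
      IsDualizing K (ciGrading f) 𝒲 →
      -- (1) `D` preserves maximal Cohen-Macaulay modules and commutes with reduction modulo `x`
      (∀ (M : Type v) [AddCommGroup M] [Module (CIRing f) M] (ℳ : ℤ → AddSubgroup M),
        IsMCM (ciGrading f) ℳ →
          IsMCM (ciGrading f) (homGrading (R := CIRing f) ℳ 𝒲) ∧
          Nontrivial (M →ₗ[CIRing f] Ω) ∧
          ∀ x : CIRing f, IsSMulRegular M x → IsSMulRegular (CIRing f) x →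
            IsSMulRegular (M →ₗ[CIRing f] Ω) x ∧
            ∃ ε : ModElt x (M →ₗ[CIRing f] Ω) ≃ₗ[CIRing f ⧸ Ideal.span {x}]
                (ModElt x M →ₗ[CIRing f ⧸ Ideal.span {x}] ModElt x Ω),
              (∀ (φ : M →ₗ[CIRing f] Ω) (m : M),
                ε (toModElt x φ) (toModElt x m) = toModElt x (φ m)) ∧
              -- if `x` is homogeneous, this is an isomorphism of graded modules
              ∀ e : ℤ, x ∈ ciGrading f e → ∀ (k : ℤ) (a : ModElt x (M →ₗ[CIRing f] Ω)),
                a ∈ modGrading x (homGrading (R := CIRing f) ℳ 𝒲) k ↔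
                  ε a ∈ homGrading (R := CIRing f ⧸ Ideal.span {x})
                    (modGrading x ℳ) (modGrading x 𝒲) k) ∧
      -- (2) `D` is exact on short exact sequences `0 → M₁ → M₂ → M₃ → 0`
      (∀ (M₁ M₂ M₃ : Type v) [AddCommGroup M₁] [AddCommGroup M₂] [AddCommGroup M₃]
          [Module (CIRing f) M₁] [Module (CIRing f) M₂] [Module (CIRing f) M₃]
          (ℳ₁ : ℤ → AddSubgroup M₁) (ℳ₂ : ℤ → AddSubgroup M₂) (ℳ₃ : ℤ → AddSubgroup M₃),
        IsMCM (ciGrading f) ℳ₁ → IsMCM (ciGrading f) ℳ₂ → IsMCM (ciGrading f) ℳ₃ →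
        ∀ (g : M₁ →ₗ[CIRing f] M₂) (h : M₂ →ₗ[CIRing f] M₃),
          Function.Injective g → Function.Exact g h → Function.Surjective h →
            Function.Injective (LinearMap.lcomp (CIRing f) Ω h) ∧
            Function.Exact (LinearMap.lcomp (CIRing f) Ω h) (LinearMap.lcomp (CIRing f) Ω g) ∧
            Function.Surjective (LinearMap.lcomp (CIRing f) Ω g)) ∧
      -- (3) the natural map `M → D(D(M))`, `m ↦ (φ ↦ φ m)`, is an isomorphism of graded modules
      (∀ (M : Type v) [AddCommGroup M] [Module (CIRing f) M] (ℳ : ℤ → AddSubgroup M),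
        IsMCM (ciGrading f) ℳ →
          Function.Bijective
            (LinearMap.applyₗ : M →ₗ[CIRing f] (M →ₗ[CIRing f] Ω) →ₗ[CIRing f] Ω) ∧
          ∀ (k : ℤ) (m : M), m ∈ ℳ k ↔
            (LinearMap.applyₗ m : (M →ₗ[CIRing f] Ω) →ₗ[CIRing f] Ω) ∈
              homGrading (R := CIRing f) (homGrading (R := CIRing f) ℳ 𝒲) 𝒲 k) := by
  -- Algebraic closedness enters through the infinitude of `K`, needed for generic linear forms.
  have hT := ciRing_isGradedCurve hf hreg
  refine ⟨isDualizing_shift hf hreg, fun Ω _ _ 𝒲 hΩ => ?_⟩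
  obtain ⟨h₁, h₂, h₃⟩ := duality_of_isGradedCurve.{u, v, w} hT Ω 𝒲 hΩ
  exact ⟨h₁, fun M₁ M₂ M₃ _ _ _ _ _ _ _ _ ℳ₃ _ _ hM₃ => h₂ M₁ M₂ M₃ ℳ₃ hM₃, h₃⟩
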